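/- Let $N=\{1,\dots,n\}$ be a set of agents and $O=\{o_1,\dots,o_m\}$ a set of objects. Agent $i$ has a utility $u_i(o)$ for each object, and utilities of bundles are additive: $u_i(S)=\sum_{o\in S}u_i(o)$. An assignment $p=(p(1),\dots,p(n))$ is a partition of $O$ into $n$ (possibly empty) bundles. An assignment $q$ is a Pareto improvement of $p$ if $u_i(q(i))\ge u_i(p(i))$ for all $i$, with strict inequality for some $i$; $p$ is Pareto optimal if it has no Pareto improvement; $q$ is individually rational for the endowment $e$ if $u_i(q(i))\ge u_i(e(i))$ for all $i$. The utilities are bivalued if there are reals $\alpha>\beta>0$ with $u_i(o)\in\{\alpha,\beta\}$ for all $i,o$; then $p^+(i)$ and $p^-(i)$ denote the sets of objects in $p(i)$ that $i$ values at $\alpha$, respectively at $\beta$. Call $i$ a candidate agent for $p$ if $p^-(i)\neq\emptyset$, and let $G_i$ be the network with vertices $N\cup O\cup\{s,t\}$ and the following edges: $(l,o)$ with capacity $1$ whenever $u_l(o)=\alpha$; $(o,t)$ with capacity $1$ for each object $o$; $(s,l)$ with capacity $|p^+(l)|$ for each agent $l\ne i$; and $(s,i)$ with capacity $|p^+(i)|+1$.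 Algorithms are programs of a random access machine with natural-number memory, addition, truncated subtraction and comparisons, all at unit cost; the real utilities are accessed only through unit-cost comparisons of two of them. Polynomial time means a number of steps bounded by a fixed polynomial in $n+m$. Each algorithm below is a single program for all $n,m$, all bivalued utilities and all input assignments. **Theorem.** 1. There is a polynomial-time algorithm that, for bivalued utilities and an assignment $p$, decides whether $p$ is Pareto optimal and, if it is not, returns a Pareto improvement of $p$. 2. These two tasks can also be performed by an algorithm that solves at most $n$ maximum-flow problems with an arbitrary exact solver for integral maximum flows (one step per call) and otherwise takes polynomially many steps. For numbers $\alpha>\beta>0$ witnessing that the utilities are bivalued (they are determined by the utilities unless all utilities are equal), the networks solved are, up to numbering of vertices, networks $G_i$ of pairwise different candidate agents $i$. The assignment $p$ fails to be Pareto optimal if and only if one of the solved networks has maximum flow value $1+\sum_{l\in N}|p^+(l)|$; if $p$ is Pareto optimal, the networks of all candidate agents are solved. 3. For bivalued utilities, starting from any initial endowment $e$ and replacing the current assignment by any Pareto improvement of it as long as one exists, one obtains after at most $m$ replacements a Pareto optimal assignment that is individually rational for $e$. 4. There is a polynomial-time algorithm that, for bivalued utilities and an initial endowment $e$, returns a Pareto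 optimal assignment that is individually rational for $e$. -/

import Mathlib

namespace ParetoAlloc

/-! ## Assignments, additive utilities, Pareto optimality -/

/-- `u i o` is the utility of agent `i` for object `o` (`n` agents, `m` objects). -/
abbrev Utility (n m : ℕ) : Type := Fin n → Fin m → ℝ

/-- An assignment is a partition of the objects into `n` labelled, possibly empty, bundles,
given by the map that sends each object to its owner. -/
abbrev Assignment (n m : ℕ) : Type := Fin m → Fin n

/-- The bundle `p(i)` of agent `i`. -/
def bundle {n m : ℕ} (p : Assignment n m) (i : Fin n) : Finset (Fin m) :=
  Finset.univ.filter fun o => p o = i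

/-- Additive utility of agent `i` for her bundle in `p`. -/
noncomputable def bundleUtility {n m : ℕ} (u : Utility n m) (p : Assignment n m) (i : Fin n) : ℝ :=
  ∑ o ∈ bundle p i, u i o

/-- `q` Pareto dominates `p`, that is, `q` is a Pareto improvement of `p`. -/
def Dominates {n m : ℕ} (u : Utility n m) (q p : Assignment n m) : Prop :=
  (∀ i, bundleUtility u p i ≤ bundleUtility u q i) ∧
    ∃ i, bundleUtility u p i < bundleUtility u q i

def ParetoOptimal {n m : ℕ} (u : Utility n m) (p : Assignment n m) : Prop :=
  ¬ ∃ q : Assignment n m, Dominates u q p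

/-- `p` is individually rational for the initial endowment `e`. -/
def IndividuallyRational {n m : ℕ} (u : Utility n m) (e p : Assignment n m) : Prop :=
  ∀ i, bundleUtility u e i ≤ bundleUtility u p i

/-- The utilities are bivalued, with values `α > β > 0`. -/
def BivaluedWith {n m : ℕ} (u : Utility n m) (α β : ℝ) : Prop :=
  0 < β ∧ β < α ∧ ∀ i o, u i o = α ∨ u i o = β

def Bivalued {n m : ℕ} (u : Utility n m) : Prop :=
  ∃ α β : ℝ, BivaluedWith u α β

/-- The objects that `i` owns in `p` and to which she gives the value `c`. With `c = α` these are
her top objects `p⁺(i)`, and with `c = β` her other objects `p⁻(i)`. -/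
noncomputable def bundleAt {n m : ℕ} (u : Utility n m) (c : ℝ) (p : Assignment n m) (i : Fin n) :
    Finset (Fin m) :=
  (bundle p i).filter fun o => u i o = c

/-! ## Flow networks -/

/-- A flow network with natural-number capacities; capacity `0` means that there is no edge. -/
structure FlowNetwork (V : Type) where
  cap : V → V → ℕ
  source : V
  sink : V

/-- Integral flows: capacity constraints, and conservation outside the source and the sink. -/
def FlowNetwork.IsFlow {V : Type} [Fintype V] (G : FlowNetwork V) (f : V → V → ℕ) : Prop :=
  (∀ v w, f v w ≤ G.cap v w) ∧
    ∀ v, v ≠ G.source → v ≠ G.sink → ∑ w, f v w = ∑ w, f w v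

/-- The value of a flow: the net amount that leaves the source. -/
def FlowNetwork.value {V : Type} [Fintype V] (G : FlowNetwork V) (f : V → V → ℕ) : ℤ :=
  (∑ w, (f G.source w : ℤ)) - ∑ w, (f w G.source : ℤ)

def FlowNetwork.IsMaxFlow {V : Type} [Fintype V] (G : FlowNetwork V) (f : V → V → ℕ) : Prop :=
  G.IsFlow f ∧ ∀ g, G.IsFlow g → G.value g ≤ G.value f

/-- Vertices of the bipartite agents-objects network. -/
inductive Vertex (n m : ℕ) : Type
  | agent (i : Fin n)
  | object (o : Fin m)
  | source
  | sink
  deriving DecidableEq, Fintype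

/-- Capacities of the network of candidate agent `i`: an edge of capacity one from `l` to each of
her top objects, an edge of capacity one from each object to the sink, and an edge from the source
to `l` of capacity `|p⁺(l)|`, increased by one for `l = i`. -/
noncomputable def improvementCap {n m : ℕ} (u : Utility n m) (α : ℝ) (p : Assignment n m)
    (i : Fin n) : Vertex n m → Vertex n m → ℕ
  | .agent l, .object o => if u l o = α then 1 else 0
  | .object _, .sink => 1
  | .source, .agent l => (bundleAt u α p l).card + if l = i then 1 else 0
  | _, _ => 0

noncomputable def improvementNetwork {n m : ℕ} (u : Utility n m) (α : ℝ) (p : Assignment n m)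
    (i : Fin n) : FlowNetwork (Vertex n m) where
  cap := improvementCap u α p i
  source := .source
  sink := .sink

/-- The sum of all `|p⁺(l)|`, plus one. -/
noncomputable def targetValue {n m : ℕ} (u : Utility n m) (α : ℝ) (p : Assignment n m) : ℤ :=
  (∑ l, ((bundleAt u α p l).card : ℤ)) + 1

/-! ## Machine model

A random access machine with natural-number variables, two-dimensional natural-number arrays,
addition, truncated subtraction and comparison, and structured control flow. Every elementary
operation costs one step. There is no multiplication, so one step lengthens numbers by at most one
bit. The utilities can be real numbers; they are read-only, and the only access to them is the
unit-cost comparison of two of them. One further instruction poses a maximum-flow problem to an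
external solver; ordinary programs do not contain it. -/

structure State where
  vars : ℕ → ℕ
  arrs : ℕ → ℕ → ℕ → ℕ

def State.setVar (σ : State) (x v : ℕ) : State where
  vars := Function.update σ.vars x v
  arrs := σ.arrs

def State.setArr (σ : State) (a i j v : ℕ) : State where
  vars := σ.vars
  arrs := fun a' i' j' => if a' = a ∧ i' = i ∧ j' = j then v else σ.arrs a' i' j'

inductive Expr : Type
  | const (k : ℕ)
  | var (x : ℕ)
  | get (a : ℕ) (i j : Expr)
  | add (e e' : Expr)
  | sub (e e' : Expr)

def Expr.eval (σ : State) : Expr → ℕ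
  | .const k => k
  | .var x => σ.vars x
  | .get a i j => σ.arrs a (i.eval σ) (j.eval σ)
  | .add e e' => e.eval σ + e'.eval σ
  | .sub e e' => e.eval σ - e'.eval σ

/-- The number of steps needed to evaluate an expression. -/
def Expr.cost : Expr → ℕ
  | .const _ => 1
  | .var _ => 1
  | .get _ i j => i.cost + j.cost + 1
  | .add e e' => e.cost + e'.cost + 1
  | .sub e e' => e.cost + e'.cost + 1

/-- `utilLt i o i' o'` asks whether agent `i` values object `o` less than agent `i'` values
object `o'`. -/
inductive Test : Type
  | lt (e e' : Expr)
  | utilLt (i o i' o' : Expr)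
  | not (b : Test)
  | and (b b' : Test)

/-- The utility table as a program addresses it, with `0` outside its range. -/
noncomputable def utilTable {n m : ℕ} (u : Utility n m) (i o : ℕ) : ℝ :=
  if h : i < n ∧ o < m then u ⟨i, h.1⟩ ⟨o, h.2⟩ else 0

def Test.Holds {n m : ℕ} (u : Utility n m) (σ : State) : Test → Prop
  | .lt e e' => e.eval σ < e'.eval σ
  | .utilLt i o i' o' =>
      utilTable u (i.eval σ) (o.eval σ) < utilTable u (i'.eval σ) (o'.eval σ)
  | .not b => ¬ b.Holds u σ
  | .and b b' => b.Holds u σ ∧ b'.Holds u σ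

def Test.cost : Test → ℕ
  | .lt e e' => e.cost + e'.cost + 1
  | .utilLt i o i' o' => i.cost + o.cost + i'.cost + o'.cost + 1
  | .not b => b.cost + 1
  | .and b b' => b.cost + b'.cost + 1

/-- `maxflow a f k s t` asks for a maximum flow in the network on `0, …, k - 1` with capacities in
array `a`, source `s` and sink `t`; the answer is written to array `f`. -/
inductive Prog : Type
  | skip
  | assign (x : ℕ) (e : Expr)
  | store (a : ℕ) (i j e : Expr)
  | seq (P Q : Prog)
  | ite (b : Test) (P Q : Prog)
  | while (b : Test) (P : Prog)
  | maxflow (a f : ℕ) (k s t : Expr)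

/-- The program poses no problem to an external solver. -/
def Prog.CallFree : Prog → Prop
  | .skip => True
  | .assign _ _ => True
  | .store _ _ _ _ => True
  | .seq P Q => P.CallFree ∧ Q.CallFree
  | .ite _ P Q => P.CallFree ∧ Q.CallFree
  | .while _ P => P.CallFree
  | .maxflow _ _ _ _ _ => False

/-- An external solver answers each network on `0, …, k - 1` by a matrix. -/
abbrev Solver : Type := (k : ℕ) → FlowNetwork (Fin k) → Fin k → Fin k → ℕ

/-- The solver answers each maximum-flow problem by a maximum flow. -/
def Solver.Correct (F : Solver) : Prop :=
  ∀ (k : ℕ) (G : FlowNetwork (Fin k)), G.IsMaxFlow (F k G)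

/-- A network posed to the external solver. -/
abbrev Query : Type := (k : ℕ) × FlowNetwork (Fin k)

def State.readNetwork (σ : State) (a k : ℕ) (s t : Fin k) : FlowNetwork (Fin k) where
  cap := fun v w => σ.arrs a v w
  source := s
  sink := t

def State.writeMatrix (σ : State) (f k : ℕ) (g : Fin k → Fin k → ℕ) : State where
  vars := σ.vars
  arrs := fun a i j =>
    if h : a = f ∧ i < k ∧ j < k then g ⟨i, h.2.1⟩ ⟨j, h.2.2⟩ else σ.arrs a i j

/-- `Runs F u P σ σ' t qs`: with utilities `u` and external solver `F`, the program `P` started in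
`σ` halts in `σ'` after `t` steps, and `qs` lists, in order, the networks posed to `F`. -/
inductive Runs (F : Solver) {n m : ℕ} (u : Utility n m) :
    Prog → State → State → ℕ → List Query → Prop
  | skip (σ : State) : Runs F u .skip σ σ 1 []
  | assign (σ : State) (x : ℕ) (e : Expr) :
      Runs F u (.assign x e) σ (σ.setVar x (e.eval σ)) (e.cost + 1) []
  | store (σ : State) (a : ℕ) (i j e : Expr) :
      Runs F u (.store a i j e) σ (σ.setArr a (i.eval σ) (j.eval σ) (e.eval σ))
        (i.cost + j.cost + e.cost + 1) []
  | seq {P Q : Prog} {σ σ' σ'' : State} {t t' : ℕ} {qs qs' : List Query}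
      (hP : Runs F u P σ σ' t qs) (hQ : Runs F u Q σ' σ'' t' qs') :
      Runs F u (.seq P Q) σ σ'' (t + t') (qs ++ qs')
  | iteTrue {b : Test} {P Q : Prog} {σ σ' : State} {t : ℕ} {qs : List Query}
      (hb : b.Holds u σ) (hP : Runs F u P σ σ' t qs) :
      Runs F u (.ite b P Q) σ σ' (b.cost + 1 + t) qs
  | iteFalse {b : Test} {P Q : Prog} {σ σ' : State} {t : ℕ} {qs : List Query}
      (hb : ¬ b.Holds u σ) (hQ : Runs F u Q σ σ' t qs) :
      Runs F u (.ite b P Q) σ σ' (b.cost + 1 + t) qs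
  | whileFalse {b : Test} {P : Prog} {σ : State} (hb : ¬ b.Holds u σ) :
      Runs F u (.while b P) σ σ (b.cost + 1) []
  | whileTrue {b : Test} {P : Prog} {σ σ' σ'' : State} {t t' : ℕ} {qs qs' : List Query}
      (hb : b.Holds u σ) (hP : Runs F u P σ σ' t qs)
      (hW : Runs F u (.while b P) σ' σ'' t' qs') :
      Runs F u (.while b P) σ σ'' (b.cost + 1 + t + t') (qs ++ qs')
  | maxflow (σ : State) (a f : ℕ) (k s t : Expr)
      (hs : s.eval σ < k.eval σ) (ht : t.eval σ < k.eval σ) :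
      Runs F u (.maxflow a f k s t) σ
        (σ.writeMatrix f (k.eval σ)
          (F (k.eval σ) (σ.readNetwork a (k.eval σ) ⟨s.eval σ, hs⟩ ⟨t.eval σ, ht⟩)))
        (k.cost + s.cost + t.cost + 1)
        [⟨k.eval σ, σ.readNetwork a (k.eval σ) ⟨s.eval σ, hs⟩ ⟨t.eval σ, ht⟩⟩]

/-- The posed network is the network `G`, with its vertices numbered in some way. -/
def Query.IsNumberingOf {V : Type} (Q : Query) (G : FlowNetwork V) : Prop :=
  ∃ e : V ≃ Fin Q.1, (∀ v w, Q.2.cap (e v) (e w) = G.cap v w) ∧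
    Q.2.source = e G.source ∧ Q.2.sink = e G.sink

/-! ## Input and output -/

/-- Input: variable `0` holds the number of agents, variable `1` the number of objects, and row `0`
of array `0` lists the owners of the objects in `p`. All other memory is zero. -/
def inputState {n m : ℕ} (p : Assignment n m) : State where
  vars := fun x => if x = 0 then n else if x = 1 then m else 0
  arrs := fun a i o => if h : a = 0 ∧ i = 0 ∧ o < m then p ⟨o, h.2.2⟩ else 0

/-- Row `0` of array `0` lists the owners of the objects in `q`. -/
def State.HoldsAssignment {n m : ℕ} (σ : State) (q : Assignment n m) : Prop :=
  ∀ o : Fin m, σ.arrs 0 0 o = q o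

/-- The final state answers both tasks: variable `0` is `0` if `p` is Pareto optimal, and `1` if
not; in the second case a Pareto improvement of `p` is returned, in the first one `p` itself. -/
def AnswersImprovement {n m : ℕ} (u : Utility n m) (p : Assignment n m) (σ : State) : Prop :=
  (ParetoOptimal u p ∧ σ.vars 0 = 0 ∧ σ.HoldsAssignment p) ∨
    ∃ q : Assignment n m, Dominates u q p ∧ σ.vars 0 = 1 ∧ σ.HoldsAssignment q

/-- The record `qs` of posed networks consists of the improvement networks of different candidate
agents, agents `i` with `p⁻(i) ≠ ∅`. If `p` is not Pareto optimal, one of these networks has a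
maximum flow of the target value; otherwise the networks of all candidate agents have been posed and
none has. -/
def DecidedByFlows {n m : ℕ} (u : Utility n m) (α β : ℝ) (p : Assignment n m)
    (qs : List Query) : Prop :=
  ∃ cs : List (Fin n), cs.Nodup ∧ (∀ i ∈ cs, (bundleAt u β p i).Nonempty) ∧
    List.Forall₂ (fun Q i => Query.IsNumberingOf Q (improvementNetwork u α p i)) qs cs ∧
    (¬ ParetoOptimal u p ↔ ∃ i ∈ cs, ∃ f,
      (improvementNetwork u α p i).IsMaxFlow f ∧
        (improvementNetwork u α p i).value f = targetValue u α p) ∧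
    (ParetoOptimal u p → ∀ i, (bundleAt u β p i).Nonempty → i ∈ cs)

end ParetoAlloc

open ParetoAlloc

/-! Call an object a top object of an agent who values it at `α`. Every object is worth `β` to its
owner and a top object `α - β` more, so the utility of a bundle depends only on its size and its
number of top objects (`bundleUtility_eq`). The sizes always add up to `m`. Hence a Pareto
improvement strictly increases the total number of top objects (`Dominates.sum_card_lt`), which
never exceeds `m`: at most `m` improvements are possible.

Optimality is tested one candidate `i` at a time: can top objects be matched so that `i` gets one
more than in `p` and everybody else as many as before (`Augments`)? If so, the matching extends to
bundles of the old sizes, because `i` owned an object that is not a top object, and this is a Pareto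
improvement (`Augments.dominates`). If not, the agents reachable from `i` by alternating exchanges
form a set that already owns, as top objects, all top objects of its members (`exists_closedUnder`).
Let `R` be the union of these sets over all candidates. In any Pareto improvement the agents of `R`
gain no top objects in total, so to be no worse off they need at least as many objects as before.
The others, who own only top objects, then lose at least what `R` gains in size, each object at its
full value `α`, so total utility cannot rise (`paretoOptimal_of_closed`,
`paretoOptimal_of_not_augments`).

Whether `i` can be served is decided either by the alternating search itself (`exec_search`) or by a
flow: the network of `i` has a flow of the target value exactly if all source edges can be
saturated, that is, if the matching exists (`maxFlow_value_iff`). Flows are integral by definition,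
so no rounding is needed.

The programs are written in a language whose only loops are bounded. There a program denotes a total
function `exec` on states, its running time is read off its syntax (`runs_exec`), and its
correctness is shown by loop invariants. The value `α` is recognised by comparisons as the maximal
utility (`Bivalued.exists_max`). Both versions share the program `improve` and its proof
`improve_correct`; they differ only in the subprogram, specified by `Finds`, that serves one
candidate. -/

namespace ParetoAlloc

/-! ## A language of bounded loops -/

/-- The bounds of the loops: the agents, the objects, or all vertices of the networks. -/
inductive LoopRange : Type
  | agents
  | objects
  | vertices

def LoopRange.expr : LoopRange → Expr
  | .agents => .var 0
  | .objects => .var 1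
  | .vertices => .add (.add (.var 0) (.var 1)) (.const 2)

def LoopRange.size (σ : State) : LoopRange → ℕ
  | .agents => σ.vars 0
  | .objects => σ.vars 1
  | .vertices => σ.vars 0 + σ.vars 1 + 2

/-- Programs with bounded loops. The call `maxflow a f` concerns the vertices `0, …, n + m + 1`,
the last two of which are the source and the sink. -/
inductive LoopProg : Type
  | assign (x : ℕ) (e : Expr)
  | store (a : ℕ) (i j e : Expr)
  | seq (P Q : LoopProg)
  | cond (b : Test) (P : LoopProg)
  | loop (x : ℕ) (r : LoopRange) (P : LoopProg)
  | maxflow (a f : ℕ)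

infixr:60 " ;; " => LoopProg.seq

namespace LoopProg

def compile : LoopProg → Prog
  | assign x e => .assign x e
  | store a i j e => .store a i j e
  | seq P Q => .seq P.compile Q.compile
  | cond b P => .ite b P.compile .skip
  | loop x r P => .seq (.assign x (.const 0))
      (.while (.lt (.var x) r.expr)
        (.seq P.compile (.assign x (.add (.var x) (.const 1)))))
  | maxflow a f => .maxflow a f LoopRange.vertices.expr (.add (.var 0) (.var 1))
      (.add (.add (.var 0) (.var 1)) (.const 1))

/-- A syntactic over-approximation with Boolean values, so that for concrete programs the side
conditions of the frame rules `exec_vars` and `exec_arrs` hold by `rfl`. -/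
def writesVar : LoopProg → ℕ → Bool
  | assign x _, y => x == y
  | store _ _ _ _, _ => false
  | seq P Q, y => P.writesVar y || Q.writesVar y
  | cond _ P, y => P.writesVar y
  | loop x _ P, y => x == y || P.writesVar y
  | maxflow _ _, _ => false

def writesArr : LoopProg → ℕ → Bool
  | assign _ _, _ => false
  | store a _ _ _, b => a == b
  | seq P Q, b => P.writesArr b || Q.writesArr b
  | cond _ P, b => P.writesArr b
  | loop _ _ P, b => P.writesArr b
  | maxflow _ f, b => f == b

/-- No loop body changes the counter of its loop. -/
def CountersKept : LoopProg → Bool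
  | seq P Q => P.CountersKept && Q.CountersKept
  | cond _ P => P.CountersKept
  | loop x _ P => !(P.writesVar x) && P.CountersKept
  | _ => true

/-- A time bound, as a polynomial in the number of agents and objects. -/
noncomputable def time : LoopProg → Polynomial ℕ
  | assign _ e => (e.cost + 1 : ℕ)
  | store _ i j e => (i.cost + j.cost + e.cost + 1 : ℕ)
  | seq P Q => P.time + Q.time
  | cond b P => P.time + (b.cost + 2 : ℕ)
  -- The longest range has `n + m + 2` rounds. Besides its body, a round costs at most 8 steps for
  -- the test and 4 for the increment; the final failing test and the initial assignment cost at
  -- most 8 + 2.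
  | loop _ _ P => (Polynomial.X + 2) * (P.time + 12) + 10
  | maxflow _ _ => 14

/-! ### Semantics, frame rules and running time of bounded-loop programs. -/

section Semantics

variable (F : Solver) {n m : ℕ} (u : Utility n m)

/-- The state in which the `k`-th round of a loop with body `f` begins. -/
def rounds (x : ℕ) (f : State → State) (σ : State) : ℕ → State
  | 0 => σ.setVar x 0
  | k + 1 => (f (rounds x f σ k)).setVar x (k + 1)

/-- The network on `0, …, n + m + 1` that array `a` holds. -/
def network (a : ℕ) (σ : State) : FlowNetwork (Fin (σ.vars 0 + σ.vars 1 + 2)) :=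
  σ.readNetwork a (σ.vars 0 + σ.vars 1 + 2) ⟨σ.vars 0 + σ.vars 1, by omega⟩
    ⟨σ.vars 0 + σ.vars 1 + 1, by omega⟩

open Classical in
/-- The state in which a program halts. -/
noncomputable def exec : LoopProg → State → State
  | assign x e, σ => σ.setVar x (e.eval σ)
  | store a i j e, σ => σ.setArr a (i.eval σ) (j.eval σ) (e.eval σ)
  | seq P Q, σ => Q.exec (P.exec σ)
  | cond b P, σ => if b.Holds u σ then P.exec σ else σ
  | loop x r P, σ => rounds x P.exec σ (r.size σ)
  | maxflow a f, σ => σ.writeMatrix f _ (F _ (network a σ))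

open Classical in
/-- The networks that a program poses to the solver. -/
noncomputable def queries : LoopProg → State → List Query
  | seq P Q, σ => P.queries σ ++ Q.queries (P.exec F u σ)
  | cond b P, σ => if b.Holds u σ then P.queries σ else []
  | loop x r P, σ =>
      (List.range (r.size σ)).flatMap fun k => P.queries (rounds x (P.exec F u) σ k)
  | maxflow a _, σ => [⟨_, network a σ⟩]
  | _, _ => []

variable {F u}

theorem exec_assign (x : ℕ) (e : Expr) (σ : State) :
    (assign x e).exec F u σ = σ.setVar x (e.eval σ) := rfl

theorem exec_store (a : ℕ) (i j e : Expr) (σ : State) :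
    (store a i j e).exec F u σ = σ.setArr a (i.eval σ) (j.eval σ) (e.eval σ) := rfl

theorem exec_seq (P Q : LoopProg) (σ : State) :
    (P ;; Q).exec F u σ = Q.exec F u (P.exec F u σ) := rfl

theorem exec_cond_pos {b : Test} {σ : State} (h : b.Holds u σ) (P : LoopProg) :
    (cond b P).exec F u σ = P.exec F u σ := if_pos h

theorem exec_cond_neg {b : Test} {σ : State} (h : ¬ b.Holds u σ) (P : LoopProg) :
    (cond b P).exec F u σ = σ := if_neg h

theorem queries_seq (P Q : LoopProg) (σ : State) :
    (P ;; Q).queries F u σ = P.queries F u σ ++ Q.queries F u (P.exec F u σ) := rfl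

theorem queries_cond_pos {b : Test} {σ : State} (h : b.Holds u σ) (P : LoopProg) :
    (cond b P).queries F u σ = P.queries F u σ := if_pos h

theorem queries_cond_neg {b : Test} {σ : State} (h : ¬ b.Holds u σ) (P : LoopProg) :
    (cond b P).queries F u σ = [] := if_neg h

theorem rounds_vars {x y : ℕ} {f : State → State} {σ : State}
    (hf : ∀ τ, (f τ).vars y = τ.vars y) (hx : x ≠ y) (k : ℕ) :
    (rounds x f σ k).vars y = σ.vars y := by
  induction k with
  | zero => simp [rounds, State.setVar, Function.update_of_ne hx.symm]
  | succ k ih => simp [rounds, State.setVar, Function.update_of_ne hx.symm, hf, ih]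

theorem rounds_counter {x : ℕ} {f : State → State} {σ : State} (k : ℕ) :
    (rounds x f σ k).vars x = k := by
  cases k <;> simp [rounds, State.setVar]

theorem rounds_arrs {x a : ℕ} {f : State → State} {σ : State}
    (hf : ∀ τ, (f τ).arrs a = τ.arrs a) (k : ℕ) :
    (rounds x f σ k).arrs a = σ.arrs a := by
  induction k with
  | zero => rfl
  | succ k ih => simpa [rounds, State.setVar, hf] using ih

theorem exec_vars {P : LoopProg} {y : ℕ} (h : P.writesVar y = false) (σ : State) :
    (P.exec F u σ).vars y = σ.vars y := by
  induction P generalizing σ with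
  | assign x e =>
    have hxy : y ≠ x := by
      rintro rfl; simp [writesVar] at h
    simp [exec, State.setVar, Function.update_of_ne hxy]
  | store a i j e => rfl
  | seq P Q hP hQ =>
    simp only [writesVar, Bool.or_eq_false_iff] at h
    simp [exec, hP h.1, hQ h.2]
  | cond b P hP =>
    simp only [exec]
    split
    · exact hP h σ
    · rfl
  | loop x r P hP =>
    simp only [writesVar, Bool.or_eq_false_iff, beq_eq_false_iff_ne] at h
    exact rounds_vars (hP h.2) h.1 _
  | maxflow a f => rfl

theorem exec_arrs {P : LoopProg} {b : ℕ} (h : P.writesArr b = false) (σ : State) :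
    (P.exec F u σ).arrs b = σ.arrs b := by
  induction P generalizing σ with
  | assign x e => rfl
  | store a i j e =>
    have hab : b ≠ a := by
      rintro rfl; simp [writesArr] at h
    funext i' j'
    simp [exec, State.setArr, hab]
  | seq P Q hP hQ =>
    simp only [writesArr, Bool.or_eq_false_iff] at h
    simp [exec, hP h.1, hQ h.2]
  | cond b P hP =>
    simp only [exec]
    split
    · exact hP h σ
    · rfl
  | loop x r P hP => exact rounds_arrs (hP h) _
  | maxflow a f =>
    have hab : b ≠ f := by
      rintro rfl; simp [writesArr] at h
    funext i' j'
    simp [exec, State.writeMatrix, hab]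

theorem size_congr {σ τ : State} (h0 : τ.vars 0 = σ.vars 0) (h1 : τ.vars 1 = σ.vars 1)
    (r : LoopRange) : r.size τ = r.size σ := by
  cases r <;> simp [LoopRange.size, h0, h1]

theorem eval_expr (σ : State) (r : LoopRange) : r.expr.eval σ = r.size σ := by
  cases r <;> rfl

theorem cost_expr_le (r : LoopRange) : r.expr.cost ≤ 5 := by
  cases r <;> simp [LoopRange.expr, Expr.cost]

/-- Induction on the number `d` of rounds still to come. The bound is evaluated anew in every test,
but it depends only on variables 0 and 1, which the body does not write, so it keeps its initial
value. -/
theorem runs_while {x : ℕ} {r : LoopRange} {P : LoopProg} {σ : State} {B : ℕ}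
    (h0 : P.writesVar 0 = false) (h1 : P.writesVar 1 = false) (hx : P.writesVar x = false)
    (hx0 : x ≠ 0) (hx1 : x ≠ 1)
    (hP : ∀ k < r.size σ, ∃ t, Runs F u P.compile (rounds x (P.exec F u) σ k)
      (P.exec F u (rounds x (P.exec F u) σ k)) t (P.queries F u (rounds x (P.exec F u) σ k)) ∧
      t ≤ B) (d : ℕ) :
    ∀ k, k + d = r.size σ → ∃ t, Runs F u
      (.while (.lt (.var x) r.expr) (.seq P.compile (.assign x (.add (.var x) (.const 1)))))
      (rounds x (P.exec F u) σ k) (rounds x (P.exec F u) σ (r.size σ)) t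
      ((List.range' k d).flatMap fun k => P.queries F u (rounds x (P.exec F u) σ k)) ∧
      t ≤ d * (B + 12) + 8 := by
  have hsize : ∀ k, r.size (rounds x (P.exec F u) σ k) = r.size σ := fun k =>
    size_congr (rounds_vars (fun τ => exec_vars h0 τ) hx0 k)
      (rounds_vars (fun τ => exec_vars h1 τ) hx1 k) r
  have hcost := cost_expr_le r
  induction d with
  | zero =>
    intro k hk
    obtain rfl : k = r.size σ := by omega
    refine ⟨_, Runs.whileFalse ?_, ?_⟩
    · simp [Test.Holds, Expr.eval, eval_expr, hsize, rounds_counter]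
    · simp only [Test.cost, Expr.cost]; omega
  | succ d ih =>
    intro k hk
    obtain ⟨t, ht, htB⟩ := hP k (by omega)
    obtain ⟨t', ht', htB'⟩ := ih (k + 1) (by omega)
    have hinc := Runs.assign (F := F) (u := u) (P.exec F u (rounds x (P.exec F u) σ k)) x
      (.add (.var x) (.const 1))
    have hval : Expr.eval (P.exec F u (rounds x (P.exec F u) σ k)) (.add (.var x) (.const 1))
        = k + 1 := by
      simp [Expr.eval, exec_vars hx, rounds_counter]
    rw [hval] at hinc
    have hbody := Runs.whileTrue (b := .lt (.var x) r.expr) (by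
      simp only [Test.Holds, Expr.eval, eval_expr, hsize, rounds_counter]; omega)
      (Runs.seq ht hinc) ht'
    refine ⟨_, by simpa [List.range'_succ] using hbody, ?_⟩
    simp only [Test.cost, Expr.cost]
    nlinarith

/-- The compiled program halts in the state `exec`, within polynomial time. -/
theorem runs_exec {P : LoopProg} (hP : P.CountersKept = true) (h0 : P.writesVar 0 = false)
    (h1 : P.writesVar 1 = false) {N : ℕ} (σ : State) (hN : σ.vars 0 + σ.vars 1 ≤ N) :
    ∃ t, Runs F u P.compile σ (P.exec F u σ) t (P.queries F u σ) ∧ t ≤ P.time.eval N := by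
  induction P generalizing σ with
  | assign x e => exact ⟨_, Runs.assign σ x e, by simp [time]⟩
  | store a i j e => exact ⟨_, Runs.store σ a i j e, by simp [time]⟩
  | seq P Q ihP ihQ =>
    simp only [CountersKept, Bool.and_eq_true, writesVar, Bool.or_eq_false_iff] at hP h0 h1
    obtain ⟨t, ht, hb⟩ := ihP hP.1 h0.1 h1.1 σ hN
    obtain ⟨t', ht', hb'⟩ := ihQ hP.2 h0.2 h1.2 (P.exec F u σ)
      (by rwa [exec_vars h0.1, exec_vars h1.1])
    exact ⟨_, Runs.seq ht ht', by simpa [time] using Nat.add_le_add hb hb'⟩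
  | cond b P ih =>
    obtain ⟨t, ht, hb⟩ := ih hP h0 h1 σ hN
    by_cases h : b.Holds u σ
    · refine ⟨_, by simpa [compile, exec, queries, h] using Runs.iteTrue h ht, ?_⟩
      simp [time]; omega
    · refine ⟨_, by simpa [compile, exec, queries, h] using Runs.iteFalse h (Runs.skip σ), ?_⟩
      simp [time]; omega
  | loop x r P ih =>
    simp only [CountersKept, Bool.and_eq_true, Bool.not_eq_true', writesVar,
      Bool.or_eq_false_iff, beq_eq_false_iff_ne] at hP h0 h1
    obtain ⟨t, ht, hb⟩ := runs_while (F := F) (u := u) (x := x) (r := r) (σ := σ)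
      (B := P.time.eval N) h0.2 h1.2 hP.1 h0.1 h1.1 (fun k _ => ih hP.2 h0.2 h1.2 _ (by
        rwa [rounds_vars (fun τ => exec_vars h0.2 τ) h0.1,
          rounds_vars (fun τ => exec_vars h1.2 τ) h1.1])) (r.size σ) 0 (by omega)
    refine ⟨_, by
      simpa [compile, exec, queries, List.range_eq_range', rounds, Expr.eval] using
        Runs.seq (Runs.assign (F := F) (u := u) σ x (.const 0)) ht, ?_⟩
    have hr : r.size σ ≤ N + 2 := by cases r <;> simp only [LoopRange.size] <;> omega
    have := Nat.mul_le_mul_right (P.time.eval N + 12) hr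
    simp [time, Expr.cost]
    omega
  | maxflow a f =>
    refine ⟨_, Runs.maxflow σ a f _ _ _ ?_ ?_, ?_⟩
    · simp [LoopRange.expr, Expr.eval]
    · simp [LoopRange.expr, Expr.eval]
    · simp [time, LoopRange.expr, Expr.cost]

/-- Induction over the rounds of a loop, with a record of the posed networks. -/
theorem loop_induction_queries {x : ℕ} {r : LoopRange} {P : LoopProg} {σ : State}
    (Inv : ℕ → State → List Query → Prop) (zero : Inv 0 (σ.setVar x 0) [])
    (step : ∀ k < r.size σ, ∀ τ qs,
      (∀ y, (loop x r P).writesVar y = false → τ.vars y = σ.vars y) →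
      (∀ a, P.writesArr a = false → τ.arrs a = σ.arrs a) → τ.vars x = k → Inv k τ qs →
        Inv (k + 1) ((P.exec F u τ).setVar x (k + 1)) (qs ++ P.queries F u τ)) :
    Inv (r.size σ) ((loop x r P).exec F u σ) ((loop x r P).queries F u σ) := by
  suffices h : ∀ k ≤ r.size σ, Inv k (rounds x (P.exec F u) σ k)
      ((List.range k).flatMap fun k => P.queries F u (rounds x (P.exec F u) σ k)) from
    h _ le_rfl
  intro k
  induction k with
  | zero => exact fun _ => zero
  | succ k ih =>
    intro hk
    have := step k hk _ _ (fun y hy => ?_) (fun a ha => rounds_arrs (fun τ => exec_arrs ha τ) k)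
      (rounds_counter k) (ih (by omega))
    · simpa [List.range_succ, rounds] using this
    · simp only [writesVar, Bool.or_eq_false_iff, beq_eq_false_iff_ne] at hy
      exact rounds_vars (fun τ => exec_vars hy.2 τ) hy.1 k

theorem loop_induction {x : ℕ} {r : LoopRange} {P : LoopProg} {σ : State}
    (Inv : ℕ → State → Prop) (zero : Inv 0 (σ.setVar x 0))
    (step : ∀ k < r.size σ, ∀ τ,
      (∀ y, (loop x r P).writesVar y = false → τ.vars y = σ.vars y) →
      (∀ a, P.writesArr a = false → τ.arrs a = σ.arrs a) → τ.vars x = k → Inv k τ →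
        Inv (k + 1) ((P.exec F u τ).setVar x (k + 1))) :
    Inv (r.size σ) ((loop x r P).exec F u σ) :=
  loop_induction_queries (F := F) (u := u) (fun k τ _ => Inv k τ) zero
    fun k hk τ _ => step k hk τ

/-- Induction over two nested loops. The first argument of the invariant tells which pairs of
counters have been treated. -/
theorem loop_loop_induction {x y : ℕ} {r s : LoopRange} {P : LoopProg} {σ : State}
    (hx0 : x ≠ 0) (hx1 : x ≠ 1) (hy0 : y ≠ 0) (hy1 : y ≠ 1) (hyx : y ≠ x)
    (hP0 : P.writesVar 0 = false) (hP1 : P.writesVar 1 = false) (hPx : P.writesVar x = false)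
    (Inv : (ℕ → ℕ → Prop) → State → Prop) (zero : Inv (fun _ _ => False) σ)
    (setx : ∀ D τ k, Inv D τ → Inv D (τ.setVar x k))
    (sety : ∀ D τ k, Inv D τ → Inv D (τ.setVar y k))
    (step : ∀ D, ∀ k < r.size σ, ∀ l < s.size σ, ∀ τ,
      (∀ z, (loop x r (loop y s P)).writesVar z = false → τ.vars z = σ.vars z) →
      (∀ a, P.writesArr a = false → τ.arrs a = σ.arrs a) → τ.vars x = k → τ.vars y = l →
        Inv D τ → Inv (fun a b => D a b ∨ a = k ∧ b = l) (P.exec F u τ)) :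
    Inv (fun a b => a < r.size σ ∧ b < s.size σ) ((loop x r (loop y s P)).exec F u σ) := by
  have key := loop_induction (F := F) (u := u) (x := x) (r := r) (P := loop y s P) (σ := σ)
    (fun k τ => Inv (fun a b => a < k ∧ b < s.size σ) τ) (by simpa using setx _ _ 0 zero) ?_
  · exact key
  intro k hk τ hv ha hxk hI
  have hs : s.size τ = s.size σ :=
    size_congr (hv 0 (by simp [writesVar, hx0, hy0, hP0])) (hv 1 (by simp [writesVar, hx1, hy1, hP1])) s
  have inner := loop_induction (F := F) (u := u) (x := y) (r := s) (P := P) (σ := τ)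
    (fun l ρ => Inv (fun a b => a < k ∧ b < s.size σ ∨ a = k ∧ b < l) ρ)
    (by simpa using sety _ _ 0 hI) ?_
  · rw [hs] at inner
    refine setx _ _ _ ?_
    have hD : (fun a b => a < k + 1 ∧ b < s.size σ) =
        fun a b => a < k ∧ b < s.size σ ∨ a = k ∧ b < s.size σ := by
      funext a b
      exact propext (by omega)
    rwa [hD]
  · intro l hl ρ hv' ha' hyl hI'
    have h := step _ k hk l (by rwa [hs] at hl) ρ (fun z hz => ?_)
      (fun a h => (ha' a h).trans (ha a h)) ?_ hyl hI'
    · refine sety _ _ _ ?_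
      have hD : (fun a b => a < k ∧ b < s.size σ ∨ a = k ∧ b < l + 1) =
          fun a b => (a < k ∧ b < s.size σ ∨ a = k ∧ b < l) ∨ a = k ∧ b = l := by
        funext a b
        exact propext (by omega)
      rwa [hD]
    · have hz' := hz
      simp only [writesVar, Bool.or_eq_false_iff] at hz'
      rw [hv' z (by simp [writesVar, hz'.2]), hv z hz]
    · rw [hv' x (by simp [writesVar, hPx, hyx]), hxk]

end Semantics

end LoopProg

theorem Runs.queries_eq_nil {F : Solver} {n m : ℕ} {u : Utility n m} {P : Prog} {σ σ' : State}
    {t : ℕ} {qs : List Query} (h : Runs F u P σ σ' t qs) (hP : P.CallFree) : qs = [] := by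
  induction h with
  | skip | assign | store | whileFalse => rfl
  | seq _ _ ih ih' => simp [ih hP.1, ih' hP.2]
  | iteTrue _ _ ih => exact ih hP.1
  | iteFalse _ _ ih => exact ih hP.2
  | whileTrue _ _ _ ih ih' => simp [ih hP, ih' hP]
  | maxflow => exact hP.elim

/-! ## Matchings of objects with agents

A row `a : ℕ → ℕ` assigns the object `o < m` to the agent `a o` if `a o < n`, and to nobody
otherwise. `W l o` means that `o` is a top object of agent `l`. -/

/-- The number of objects that the row `a` assigns to `x`. -/
def tally (m : ℕ) (a : ℕ → ℕ) (x : ℕ) : ℕ :=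
  ∑ o ∈ Finset.range m, if a o = x then 1 else 0

theorem tally_congr {m : ℕ} {a b : ℕ → ℕ} (h : ∀ o < m, a o = b o) (x : ℕ) :
    tally m a x = tally m b x :=
  Finset.sum_congr rfl fun o ho => by rw [h o (Finset.mem_range.1 ho)]

/-- Only the summand of `o` changes. The old and the new owner appear on opposite sides to avoid
truncated subtraction. -/
theorem tally_update {m o : ℕ} (ho : o < m) (a : ℕ → ℕ) (l x : ℕ) :
    tally m (Function.update a o l) x + (if a o = x then 1 else 0) =
      tally m a x + if l = x then 1 else 0 := by
  have ho' := Finset.mem_range.2 ho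
  simp only [tally]
  rw [← Finset.add_sum_erase _ _ ho', ← Finset.add_sum_erase _ _ ho']
  have : ∑ o' ∈ (Finset.range m).erase o, (if Function.update a o l o' = x then 1 else 0) =
      ∑ o' ∈ (Finset.range m).erase o, if a o' = x then 1 else 0 :=
    Finset.sum_congr rfl fun o' h => by rw [Function.update_of_ne (Finset.ne_of_mem_erase h)]
  rw [this, Function.update_self]
  omega

/-- The objects assigned to agents in `s`, counted by agents and by objects. -/
theorem sum_tally (m : ℕ) (a : ℕ → ℕ) (s : Finset ℕ) :
    ∑ x ∈ s, tally m a x = ∑ o ∈ Finset.range m, if a o ∈ s then 1 else 0 := by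
  simp only [tally]
  rw [Finset.sum_comm]
  simp

theorem tally_succ (k : ℕ) (a : ℕ → ℕ) (x : ℕ) :
    tally (k + 1) a x = tally k a x + if a k = x then 1 else 0 :=
  Finset.sum_range_succ _ _

section Matching

variable (n m : ℕ) (W : ℕ → ℕ → Prop)

open Classical in
/-- The top objects stay with their owners; `n` stands for nobody. -/
noncomputable def topPart (p : ℕ → ℕ) (o : ℕ) : ℕ :=
  if W (p o) o then p o else n

/-- The row `M` gives only top objects to agents. -/
def IsTop (M : ℕ → ℕ) : Prop :=
  ∀ o < m, M o < n → W (M o) o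

/-- `M` gives each agent as many top objects as `p`, and one more to agent `i`. -/
def Augments (p : ℕ → ℕ) (i : ℕ) (M : ℕ → ℕ) : Prop :=
  IsTop n m W M ∧
    ∀ x < n, tally m M x = tally m (topPart n W p) x + if x = i then 1 else 0

/-- Agent `i` owns an object in `p` that is not a top object of hers. -/
def Candidate (p : ℕ → ℕ) (i : ℕ) : Prop :=
  ∃ o < m, p o = i ∧ ¬ W i o

/-- All top objects of agents in `s` are owned, as top objects, by agents in `s`. -/
def ClosedUnder (p : ℕ → ℕ) (s : Finset ℕ) : Prop :=
  ∀ l ∈ s, ∀ o < m, W l o → topPart n W p o ∈ s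

variable {n m W} {p : ℕ → ℕ} {i : ℕ}

theorem topPart_isTop : IsTop n m W (topPart n W p) := by
  intro o _ h
  unfold topPart at h ⊢
  split_ifs at h ⊢ with hW
  · exact hW
  · exact absurd h (lt_irrefl n)

theorem topPart_le (hp : ∀ o < m, p o < n) {o : ℕ} (ho : o < m) : topPart n W p o ≤ n := by
  unfold topPart
  split_ifs
  · exact (hp o ho).le
  · exact le_rfl

theorem topPart_eq_iff {x o : ℕ} (hx : x < n) : topPart n W p o = x ↔ p o = x ∧ W x o := by
  unfold topPart
  split_ifs with h
  · constructor
    · rintro rfl; exact ⟨rfl, h⟩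
    · exact fun h' => h'.1
  · constructor
    · intro h'; omega
    · rintro ⟨rfl, h'⟩; exact absurd h' h

/-- This form refers to `p` and `topPart` only, the two rows that `testCandidate` reads. -/
theorem candidate_iff (hp : ∀ o < m, p o < n) :
    Candidate m W p i ↔ ∃ o < m, p o = i ∧ ¬ topPart n W p o < n := by
  refine exists_congr fun o => and_congr_right fun ho => and_congr_right fun h => ?_
  subst h
  by_cases hW : W (p o) o <;> simp [topPart, hW, hp o ho]

theorem tally_topPart_le {x : ℕ} (hx : x < n) : tally m (topPart n W p) x ≤ tally m p x := by
  refine Finset.sum_le_sum fun o _ => ?_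
  split_ifs with h1 h2
  · exact le_rfl
  · exact absurd ((topPart_eq_iff hx).1 h1).1 h2
  · exact zero_le_one
  · exact le_rfl

/-- An object that `i` owns without valuing it most leaves room for the additional top object. This
is what allows `M` to be completed to bundles of the old sizes, and the only place where candidacy
matters for that. -/
theorem Augments.tally_le {M : ℕ → ℕ} (h : Augments n m W p i M) (hi : Candidate m W p i)
    {x : ℕ} (hx : x < n) : tally m M x ≤ tally m p x := by
  rw [h.2 x hx]
  split_ifs with hxi
  · subst hxi
    obtain ⟨o, ho, hpo, hW⟩ := hi
    refine Nat.succ_le_of_lt (Finset.sum_lt_sum (fun o _ => ?_) ⟨o, Finset.mem_range.2 ho, ?_⟩)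
    · split_ifs with h1 h2
      · exact le_rfl
      · exact absurd ((topPart_eq_iff hx).1 h1).1 h2
      · exact zero_le_one
      · exact le_rfl
    · rw [if_neg fun h' => hW ((topPart_eq_iff hx).1 h').2, if_pos hpo]
      exact zero_lt_one
  · exact tally_topPart_le hx

/-- Hall's counting argument: a closed set of agents cannot have more top objects. -/
theorem ClosedUnder.not_augments {s : Finset ℕ} (hs : ClosedUnder n m W p s)
    (hn : ∀ l ∈ s, l < n) (hi : i ∈ s) (M : ℕ → ℕ) : ¬ Augments n m W p i M := by
  rintro ⟨hM, hc⟩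
  have h1 : ∑ x ∈ s, tally m M x = ∑ x ∈ s, tally m (topPart n W p) x + 1 := by
    rw [Finset.sum_congr rfl fun x hx => hc x (hn x hx), Finset.sum_add_distrib]
    simp [hi]
  have h2 : ∑ x ∈ s, tally m M x ≤ ∑ x ∈ s, tally m (topPart n W p) x := by
    rw [sum_tally, sum_tally]
    refine Finset.sum_le_sum fun o ho => ?_
    have ho := Finset.mem_range.1 ho
    split_ifs with h h'
    · exact le_rfl
    · exact absurd (hs _ h o ho (hM o ho (hn _ h))) h'
    · exact zero_le_one
    · exact le_rfl
  omega

/-- The invariant of the search for more top objects. For each agent `l` in `V`, the row `N l` gives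
only top objects to agents, namely one more than `p` to `i` and one less to `l`, and it has not
changed the assignment of the objects whose owners are not in `V`. Here nobody, that is, `n`, counts
as an owner. -/
structure Search (n m : ℕ) (W : ℕ → ℕ → Prop) (p : ℕ → ℕ) (i : ℕ) (V : Finset ℕ)
    (N : ℕ → ℕ → ℕ) : Prop where
  mem : i ∈ V
  isTop : ∀ l ∈ V, IsTop n m W (N l)
  tally_add : ∀ l ∈ V, ∀ x < n, tally m (N l) x + (if x = l then 1 else 0) =
    tally m (topPart n W p) x + if x = i then 1 else 0
  kept : ∀ l ∈ V, ∀ o < m, topPart n W p o ∉ V → N l o = topPart n W p o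

theorem Search.init {N : ℕ → ℕ → ℕ} (h : ∀ o < m, N i o = topPart n W p o) :
    Search n m W p i {i} N where
  mem := Finset.mem_singleton_self i
  isTop l hl o ho hn := by
    rw [Finset.mem_singleton.1 hl, h o ho] at hn ⊢
    exact topPart_isTop o ho hn
  tally_add l hl x _ := by rw [Finset.mem_singleton.1 hl, tally_congr h]
  kept l hl o ho _ := by rw [Finset.mem_singleton.1 hl, h o ho]

/-- One alternating exchange. In `N l` agent `l` is one object short, and `o` is still with its old
owner because that owner is not in `V`. Giving `o` to `l` makes up for the shortage and passes it on
to the owner. Rows are compared only below `m`, so that `N'` may be the content of an array. -/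
theorem Search.insert {V : Finset ℕ} {N N' : ℕ → ℕ → ℕ} (h : Search n m W p i V N) {l o : ℕ}
    (hl : l ∈ V) (ho : o < m) (hW : W l o) (hV : topPart n W p o ∉ V)
    (hN : ∀ x ∈ V, ∀ o' < m, N' x o' = N x o')
    (hN' : ∀ o' < m, N' (topPart n W p o) o' = Function.update (N l) o l o') :
    Search n m W p i (insert (topPart n W p o) V) N' where
  mem := Finset.mem_insert_of_mem h.mem
  isTop x hx o' ho' hn := by
    rcases Finset.mem_insert.1 hx with rfl | hx
    · rw [hN' o' ho'] at hn ⊢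
      rcases eq_or_ne o' o with rfl | hne
      · rwa [Function.update_self]
      · rw [Function.update_of_ne hne] at hn ⊢
        exact h.isTop l hl o' ho' hn
    · rw [hN x hx o' ho'] at hn ⊢
      exact h.isTop x hx o' ho' hn
  tally_add x hx y hy := by
    rcases Finset.mem_insert.1 hx with rfl | hx
    · rw [tally_congr hN']
      have h1 := tally_update ho (N l) l y
      have h2 := h.tally_add l hl y hy
      rw [h.kept l hl o ho hV] at h1
      simp only [eq_comm (a := y)] at h2 ⊢
      omega
    · rw [tally_congr (hN x hx)]
      exact h.tally_add x hx y hy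
  kept x hx o' ho' hV' := by
    rw [Finset.mem_insert, not_or] at hV'
    rcases Finset.mem_insert.1 hx with rfl | hx
    · rw [hN' o' ho', Function.update_of_ne, h.kept l hl o' ho' hV'.2]
      rintro rfl
      exact hV'.1 rfl
    · rw [hN x hx o' ho', h.kept x hx o' ho' hV'.2]

/-- Once the shortage has been passed on to nobody, no agent is short. -/
theorem Search.augments {V : Finset ℕ} {N : ℕ → ℕ → ℕ} (h : Search n m W p i V N)
    (hn : n ∈ V) : Augments n m W p i (N n) :=
  ⟨h.isTop n hn, fun x hx => by simpa [hx.ne] using h.tally_add n hn x hx⟩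

/-- As long as `V` is not closed, an exchange enlarges it. The new member is an agent, since
reaching nobody would yield an augmentation; so the search must stop at a closed set. -/
theorem exists_closedUnder_of_search (hp : ∀ o < m, p o < n)
    (hno : ∀ M, ¬ Augments n m W p i M) (d : ℕ) : ∀ (V : Finset ℕ) (N : ℕ → ℕ → ℕ),
    Search n m W p i V N → (∀ l ∈ V, l < n) → n - V.card ≤ d →
    ∃ s : Finset ℕ, i ∈ s ∧ (∀ l ∈ s, l < n) ∧ ClosedUnder n m W p s := by
  induction d with
  | zero =>
    intro V N h hV hd
    -- Now `V` contains all agents, and an exchange leading out of it could only reach nobody.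
    have hVn : V = Finset.range n := Finset.eq_of_subset_of_card_le
      (fun l hl => Finset.mem_range.2 (hV l hl)) (by rw [Finset.card_range]; omega)
    refine ⟨V, h.mem, hV, fun l hl o ho hW => ?_⟩
    by_contra hne
    have hs := h.insert hl ho hW hne (N' := Function.update N (topPart n W p o)
        (Function.update (N l) o l))
      (fun x hx o' _ => by rw [Function.update_of_ne (by rintro rfl; exact hne hx)])
      (fun o' _ => by rw [Function.update_self])
    refine hno _ (hs.augments (Finset.mem_insert.2 (Or.inl ?_)))
    have := topPart_le (W := W) hp ho
    rw [hVn, Finset.mem_range] at hne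
    omega
  | succ d ih =>
    intro V N h hV hd
    by_cases hc : ClosedUnder n m W p V
    · exact ⟨V, h.mem, hV, hc⟩
    simp only [ClosedUnder, not_forall] at hc
    obtain ⟨l, hl, o, ho, hW, hne⟩ := hc
    have hs := h.insert hl ho hW hne (N' := Function.update N (topPart n W p o)
        (Function.update (N l) o l))
      (fun x hx o' _ => by rw [Function.update_of_ne (by rintro rfl; exact hne hx)])
      (fun o' _ => by rw [Function.update_self])
    have hlt : topPart n W p o < n := by
      refine lt_of_le_of_ne (topPart_le hp ho) fun h' => hno _ (hs.augments ?_)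
      exact Finset.mem_insert.2 (Or.inl h'.symm)
    refine ih _ _ hs (fun x hx => ?_) ?_
    · rcases Finset.mem_insert.1 hx with rfl | hx
      · exact hlt
      · exact hV x hx
    · rw [Finset.card_insert_of_notMem hne]; omega

theorem exists_closedUnder (hp : ∀ o < m, p o < n) (hi : i < n)
    (hno : ∀ M, ¬ Augments n m W p i M) :
    ∃ s : Finset ℕ, i ∈ s ∧ (∀ l ∈ s, l < n) ∧ ClosedUnder n m W p s :=
  exists_closedUnder_of_search hp hno n {i} (fun _ => topPart n W p) (Search.init fun _ _ => rfl)
    (by simpa using hi) (by omega)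

end Matching

/-! ## Bivalued utilities -/

section Bivalued

variable {n m : ℕ} {u : Utility n m} {α β : ℝ}

/-- The owners of the objects in an assignment, as a row. -/
def ownerRow (q : Assignment n m) (o : ℕ) : ℕ :=
  if h : o < m then q ⟨o, h⟩ else 0

/-- Agent `l` values object `o` at `α`. -/
def TopFor (u : Utility n m) (α : ℝ) (l o : ℕ) : Prop :=
  ∃ (hl : l < n) (ho : o < m), u ⟨l, hl⟩ ⟨o, ho⟩ = α

theorem ownerRow_val (q : Assignment n m) (o : Fin m) : ownerRow q o = q o := by
  simp [ownerRow]

theorem ownerRow_lt (q : Assignment n m) {o : ℕ} (ho : o < m) : ownerRow q o < n := by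
  simp [ownerRow, ho]

theorem topFor_val (l : Fin n) (o : Fin m) : TopFor u α l o ↔ u l o = α := by
  simp [TopFor]

theorem topPart_val (q : Assignment n m) (i : Fin n) (o : Fin m) :
    topPart n (TopFor u α) (ownerRow q) o = i ↔ q o = i ∧ u i o = α := by
  rw [topPart_eq_iff i.2, topFor_val, ownerRow_val, Fin.ext_iff]

theorem card_bundle (q : Assignment n m) (i : Fin n) :
    (bundle q i).card = tally m (ownerRow q) i := by
  rw [bundle, Finset.card_filter, tally, ← Fin.sum_univ_eq_sum_range
    (fun o => if ownerRow q o = i then 1 else 0)]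
  simp only [ownerRow_val, Fin.ext_iff]

theorem card_bundleAt (q : Assignment n m) (i : Fin n) :
    (bundleAt u α q i).card = tally m (topPart n (TopFor u α) (ownerRow q)) i := by
  classical
  rw [bundleAt, bundle, Finset.filter_filter, Finset.card_filter, tally,
    ← Fin.sum_univ_eq_sum_range
      (fun o => if topPart n (TopFor u α) (ownerRow q) o = i then 1 else 0)]
  simp only [topPart_val]

theorem bundleAt_nonempty_iff (h : BivaluedWith u α β) (p : Assignment n m) (i : Fin n) :
    (bundleAt u β p i).Nonempty ↔ Candidate m (TopFor u α) (ownerRow p) i := by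
  constructor
  · rintro ⟨o, ho⟩
    simp only [bundleAt, bundle, Finset.mem_filter, Finset.mem_univ, true_and] at ho
    refine ⟨o, o.2, by rw [ownerRow_val, ho.1], ?_⟩
    rw [topFor_val, ho.2]
    exact h.2.1.ne
  · rintro ⟨o, ho, hp, hW⟩
    refine ⟨⟨o, ho⟩, ?_⟩
    rw [topFor_val i ⟨o, ho⟩] at hW
    rw [ownerRow_val p ⟨o, ho⟩, ← Fin.ext_iff] at hp
    simp only [bundleAt, bundle, Finset.mem_filter, Finset.mem_univ, true_and]
    exact ⟨hp, (h.2.2 i ⟨o, ho⟩).resolve_left hW⟩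

/-- Count `β` for each object and a bonus `α - β` for each top object. -/
theorem bundleUtility_eq (h : BivaluedWith u α β) (q : Assignment n m) (i : Fin n) :
    bundleUtility u q i =
      β * (bundle q i).card + (α - β) * (bundleAt u α q i).card := by
  rw [bundleUtility, bundleAt, Finset.card_filter]
  push_cast
  rw [Finset.mul_sum, Finset.card_eq_sum_ones, Nat.cast_sum, Finset.mul_sum,
    ← Finset.sum_add_distrib]
  refine Finset.sum_congr rfl fun o _ => ?_
  have := h.2.1
  rcases h.2.2 i o with h | h
  · simp [h]
  · simp [h, this.ne]

theorem card_bundleAt_le (c : ℝ) (q : Assignment n m) (i : Fin n) :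
    (bundleAt u c q i).card ≤ (bundle q i).card :=
  Finset.card_le_card (Finset.filter_subset _ _)

theorem sum_card_bundle (q : Assignment n m) : ∑ i, (bundle q i).card = m := by
  have := Finset.card_eq_sum_card_fiberwise (f := q) (s := Finset.univ) (t := Finset.univ)
    (fun o _ => Finset.mem_coe.2 (Finset.mem_univ _))
  rw [Finset.card_fin] at this
  exact this.symm

/-- A reassignment of as many objects to each agent, with at least as many top objects for each
agent and more of them for some agent, is a Pareto improvement. -/
theorem dominates_of_card (h : BivaluedWith u α β) {p q : Assignment n m}
    (hc : ∀ i, (bundle q i).card = (bundle p i).card)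
    (ht : ∀ i, (bundleAt u α p i).card ≤ (bundleAt u α q i).card)
    (hi : ∃ i, (bundleAt u α p i).card < (bundleAt u α q i).card) : Dominates u q p := by
  have hpos : 0 < α - β := sub_pos.2 h.2.1
  refine ⟨fun i => ?_, hi.imp fun i hi => ?_⟩
  · rw [bundleUtility_eq h, bundleUtility_eq h, hc]
    have : ((bundleAt u α p i).card : ℝ) ≤ (bundleAt u α q i).card := by exact_mod_cast ht i
    gcongr
  · rw [bundleUtility_eq h, bundleUtility_eq h, hc]
    have : ((bundleAt u α p i).card : ℝ) < (bundleAt u α q i).card := by exact_mod_cast hi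
    gcongr

/-- Total utility rises, and in it the part `β * m` is the same for all assignments, so the total
bonus must rise. -/
theorem Dominates.sum_card_lt (h : BivaluedWith u α β) {p q : Assignment n m}
    (hd : Dominates u q p) :
    ∑ i, (bundleAt u α p i).card < ∑ i, (bundleAt u α q i).card := by
  have hs := Finset.sum_lt_sum (fun i _ => hd.1 i) (hd.2.imp fun i hi => ⟨Finset.mem_univ i, hi⟩)
  simp only [bundleUtility_eq h, Finset.sum_add_distrib, ← Finset.mul_sum, ← Nat.cast_sum,
    sum_card_bundle] at hs
  have := lt_of_mul_lt_mul_left (lt_of_add_lt_add_left hs) (sub_nonneg.2 h.2.1.le)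
  exact_mod_cast this

theorem sum_card_bundleAt_le (c : ℝ) (p : Assignment n m) :
    ∑ i, (bundleAt u c p i).card ≤ m :=
  (Finset.sum_le_sum fun i _ => card_bundleAt_le c p i).trans (sum_card_bundle p).le

/-- If the agents in `R` own, as top objects, all top objects of agents in `R`, and the other
agents own only top objects, then the assignment is Pareto optimal. -/
theorem paretoOptimal_of_closed (h : BivaluedWith u α β) (p : Assignment n m)
    (R : Finset (Fin n)) (hR : ∀ l ∈ R, ∀ o, u l o = α → p o ∈ R ∧ u (p o) o = α)
    (hR' : ∀ l ∉ R, bundleAt u β p l = ∅) : ParetoOptimal u p := by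
  rintro ⟨q, hq⟩
  have hβ := h.1
  have hαβ : 0 < α - β := sub_pos.2 h.2.1
  -- Outside `R` all owned objects are top objects.
  have hall := fun l (hl : l ∉ R) => show (bundleAt u α p l).card = (bundle p l).card by
    rw [bundleAt, Finset.filter_true_of_mem]
    intro o ho
    refine (h.2.2 l o).resolve_right fun hb => ?_
    have : o ∈ bundleAt u β p l := Finset.mem_filter.2 ⟨ho, hb⟩
    simp [hR' l hl] at this
  have htop : ∑ l ∈ R, (bundleAt u α q l).card ≤ ∑ l ∈ R, (bundleAt u α p l).card := by
    have key : ∀ q : Assignment n m, ∑ l ∈ R, (bundleAt u α q l).card =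
        (Finset.univ.filter fun o => q o ∈ R ∧ u (q o) o = α).card := by
      intro q
      rw [Finset.card_eq_sum_card_fiberwise (f := q) (t := R)]
      · refine Finset.sum_congr rfl fun l hl => congrArg _ ?_
        ext o
        simp only [bundleAt, bundle, Finset.mem_filter, Finset.mem_univ, true_and]
        constructor
        · rintro ⟨rfl, h⟩; exact ⟨⟨hl, h⟩, rfl⟩
        · rintro ⟨⟨_, h⟩, rfl⟩; exact ⟨rfl, h⟩
      · intro o ho
        simp only [Finset.coe_filter, Set.mem_ofPred_eq] at ho
        exact ho.2.1
    rw [key, key]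
    -- By closedness, any top object held inside `R` in `q` was already a top object held inside `R`
    -- in `p`.
    refine Finset.card_le_card fun o ho => ?_
    simp only [Finset.mem_filter, Finset.mem_univ, true_and] at ho ⊢
    exact hR _ ho.1 o ho.2
  set d : Fin n → ℝ := fun l => (bundle q l).card - (bundle p l).card with hd
  set g : Fin n → ℝ := fun l => (bundleAt u α q l).card - (bundleAt u α p l).card with hg
  have hdiff : ∀ l, bundleUtility u q l - bundleUtility u p l = β * d l + (α - β) * g l := by
    intro l
    rw [bundleUtility_eq h, bundleUtility_eq h, hd, hg]
    ring
  have hdsum : ∑ l ∈ R, d l + ∑ l ∈ Rᶜ, d l = 0 := by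
    rw [Finset.sum_add_sum_compl, hd, Finset.sum_sub_distrib, ← Nat.cast_sum, ← Nat.cast_sum,
      sum_card_bundle, sum_card_bundle, sub_self]
  have hgsum : ∑ l ∈ R, g l ≤ 0 := by
    rw [hg, Finset.sum_sub_distrib, ← Nat.cast_sum, ← Nat.cast_sum, sub_nonpos]
    exact_mod_cast htop
  have hge : ∀ l, 0 ≤ β * d l + (α - β) * g l := fun l => by
    rw [← hdiff]; exact sub_nonneg.2 (hq.1 l)
  -- An agent who had only top objects gains at most as many top objects as objects.
  have hRc : ∀ l ∈ Rᶜ, β * d l + (α - β) * g l ≤ α * d l := by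
    intro l hl
    have h1 : g l ≤ d l := by
      have : ((bundleAt u α q l).card : ℝ) ≤ (bundle q l).card := by
        exact_mod_cast card_bundleAt_le α q l
      simp only [hd, hg, hall l (Finset.mem_compl.1 hl)]
      linarith
    nlinarith
  have hpos : 0 < ∑ l, (β * d l + (α - β) * g l) := by
    obtain ⟨i, hi⟩ := hq.2
    refine Finset.sum_pos' (fun l _ => hge l) ⟨i, Finset.mem_univ i, ?_⟩
    rw [← hdiff]; exact sub_pos.2 hi
  rw [← Finset.sum_add_sum_compl R] at hpos
  have h1 := Finset.sum_le_sum hRc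
  rw [← Finset.mul_sum] at h1
  have h2 := Finset.sum_nonneg fun l (_ : l ∈ R) => hge l
  simp only [Finset.sum_add_distrib (s := R), ← Finset.mul_sum] at h2 hpos
  have h3 : (α - β) * ∑ l ∈ R, g l ≤ 0 := mul_nonpos_of_nonneg_of_nonpos hαβ.le hgsum
  -- With `D` the number of objects gained by `R`, the total gain in utility is at most `β * D - α *
  -- D`, up to the nonpositive term `h3`. As `D ≥ 0`, this contradicts `hpos`.
  have h4 : 0 ≤ ∑ l ∈ R, d l := nonneg_of_mul_nonneg_right (by linarith) hβ
  have h5 := mul_nonneg hαβ.le h4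
  rw [eq_neg_of_add_eq_zero_right hdsum] at h1
  linarith

/-- Without candidates whose number of top objects can be increased, an assignment is Pareto
optimal. -/
theorem paretoOptimal_of_not_augments (h : BivaluedWith u α β) (p : Assignment n m)
    (hno : ∀ i < n, Candidate m (TopFor u α) (ownerRow p) i →
      ∀ M, ¬ Augments n m (TopFor u α) (ownerRow p) i M) : ParetoOptimal u p := by
  classical
  have hs : ∀ i : Fin n, ∃ s : Finset ℕ, (bundleAt u β p i).Nonempty →
      (i : ℕ) ∈ s ∧ ClosedUnder n m (TopFor u α) (ownerRow p) s ∧ ∀ l ∈ s, l < n := by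
    intro i
    by_cases hi : (bundleAt u β p i).Nonempty
    · obtain ⟨s, h1, h2, h3⟩ := exists_closedUnder (fun o ho => ownerRow_lt p ho) i.2
        (hno i i.2 ((bundleAt_nonempty_iff h p i).1 hi))
      exact ⟨s, fun _ => ⟨h1, h3, h2⟩⟩
    · exact ⟨∅, fun h => absurd h hi⟩
  choose s hs using hs
  -- A union of closed sets is closed, and agents outside the union are not candidates.
  refine paretoOptimal_of_closed h p
    (Finset.univ.filter fun l => ∃ i, (bundleAt u β p i).Nonempty ∧ (l : ℕ) ∈ s i) ?_ ?_
  · intro l hl o ho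
    obtain ⟨i, hi, hli⟩ := (Finset.mem_filter.1 hl).2
    have hmem := (hs i hi).2.1 l hli o o.2 ((topFor_val l o).2 ho)
    -- The set contains agents only, so the object is not left to nobody: its owner holds it as a
    -- top object.
    have hlt := (hs i hi).2.2 _ hmem
    have hpo := (topPart_val p ⟨_, hlt⟩ o).1 rfl
    have hval : ((p o : Fin n) : ℕ) = topPart n (TopFor u α) (ownerRow p) o :=
      congrArg Fin.val hpo.1
    refine ⟨Finset.mem_filter.2 ⟨Finset.mem_univ _, i, hi, by rwa [hval]⟩, ?_⟩
    rw [hpo.1]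
    exact hpo.2
  · intro l hl
    by_contra hne
    have hne := Finset.nonempty_iff_ne_empty.2 hne
    exact hl (Finset.mem_filter.2 ⟨Finset.mem_univ _, l, hne, (hs l hne).1⟩)

/-! ### Termination of repeated improvement. -/

theorem IndividuallyRational.trans {e p q : Assignment n m} (h : IndividuallyRational u e p)
    (h' : IndividuallyRational u p q) : IndividuallyRational u e q :=
  fun i => (h i).trans (h' i)

/-- After `k` Pareto improvements, either the assignment is Pareto optimal or at least `k` objects
are top objects of their owners. -/
theorem progress_step (h : BivaluedWith u α β) {p q : Assignment n m} {k : ℕ}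
    (hp : ParetoOptimal u p ∨ k ≤ ∑ i, (bundleAt u α p i).card)
    (hq : ParetoOptimal u p ∧ q = p ∨ Dominates u q p) :
    ParetoOptimal u q ∨ k + 1 ≤ ∑ i, (bundleAt u α q i).card := by
  rcases hq with ⟨hpo, rfl⟩ | hd
  · exact Or.inl hpo
  · refine Or.inr ((hp.resolve_left fun hpo => hpo ⟨q, hd⟩).trans_lt (hd.sum_card_lt h))

/-- An improvement of an assignment with `m` top objects would need more than `m` of them. -/
theorem paretoOptimal_of_progress (h : BivaluedWith u α β) {p : Assignment n m}
    (hp : ParetoOptimal u p ∨ m ≤ ∑ i, (bundleAt u α p i).card) : ParetoOptimal u p := by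
  refine hp.elim id fun hm => ?_
  rintro ⟨q, hd⟩
  have h1 := hd.sum_card_lt h
  have h2 := sum_card_bundleAt_le (u := u) α q
  omega

theorem improvement_terminates (h : BivaluedWith u α β)
    {step : Assignment n m → Assignment n m} (h1 : ∀ p, ParetoOptimal u p → step p = p)
    (h2 : ∀ p, ¬ ParetoOptimal u p → Dominates u (step p) p) (e : Assignment n m) :
    IndividuallyRational u e (step^[m] e) ∧ ParetoOptimal u (step^[m] e) := by
  have key : ∀ k, IndividuallyRational u e (step^[k] e) ∧ (ParetoOptimal u (step^[k] e) ∨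
      k ≤ ∑ i, (bundleAt u α (step^[k] e) i).card) := by
    intro k
    induction k with
    | zero => exact ⟨fun _ => le_rfl, Or.inr (Nat.zero_le _)⟩
    | succ k ih =>
      rw [Function.iterate_succ_apply']
      have hstep : ParetoOptimal u (step^[k] e) ∧ step (step^[k] e) = step^[k] e ∨
          Dominates u (step (step^[k] e)) (step^[k] e) := by
        by_cases hpo : ParetoOptimal u (step^[k] e)
        · exact Or.inl ⟨hpo, h1 _ hpo⟩
        · exact Or.inr (h2 _ hpo)
      refine ⟨ih.1.trans ?_, progress_step h ih.2 hstep⟩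
      rcases hstep with hs | hs
      · rw [hs.2]; exact fun _ => le_rfl
      · exact hs.1
  exact ⟨(key m).1, paretoOptimal_of_progress h (key m).2⟩

/-- The values can be chosen so that the objects of value `α` are those of maximal value. -/
theorem Bivalued.exists_max (h : Bivalued u) : ∃ α β, BivaluedWith u α β ∧
    ∀ l o, u l o = α ↔ ∀ l' o', u l' o' ≤ u l o := by
  obtain ⟨α, β, hβ, hαβ, hu⟩ := h
  by_cases hα : ∃ l o, u l o = α
  · obtain ⟨l₀, o₀, h₀⟩ := hα
    refine ⟨α, β, ⟨hβ, hαβ, hu⟩, fun l o => ⟨fun h l' o' => ?_, fun h => ?_⟩⟩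
    · rcases hu l' o' with h' | h' <;> linarith
    · have := h l₀ o₀
      rcases hu l o with h' | h' <;> linarith
  · push Not at hα
    have hu' : ∀ l o, u l o = β := fun l o => (hu l o).resolve_left (hα l o)
    -- All utilities equal `β`, which is therefore maximal and has to serve as the high value; any
    -- smaller positive number will do as the low one.
    exact ⟨β, β / 2, ⟨by linarith, by linarith, fun l o => Or.inl (hu' l o)⟩,
      fun l o => by simp [hu']⟩

end Bivalued

open LoopProg

/-! ## Basic programs -/

/-- Array `1` becomes the table of top objects: `1` where the utility is maximal, `0` elsewhere. -/
def topTable : LoopProg :=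
  assign 10 (.const 0) ;; assign 11 (.const 0) ;;
  loop 4 .agents (loop 5 .objects
    (cond (.utilLt (.var 10) (.var 11) (.var 4) (.var 5))
      (assign 10 (.var 4) ;; assign 11 (.var 5)))) ;;
  loop 4 .agents (loop 5 .objects
    (store 1 (.var 4) (.var 5) (.const 1) ;;
      cond (.utilLt (.var 4) (.var 5) (.var 10) (.var 11))
        (store 1 (.var 4) (.var 5) (.const 0))))

/-- Row `0` of array `2` becomes `topPart` of row `0` of array `0`. -/
def findTopPart : LoopProg :=
  loop 5 .objects
    (store 2 (.const 0) (.var 5) (.var 0) ;;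
      cond (.lt (.const 0) (.get 1 (.get 0 (.const 0) (.var 5)) (.var 5)))
        (store 2 (.const 0) (.var 5) (.get 0 (.const 0) (.var 5))))

/-- Variable `8` tells whether the agent in variable `3` is a candidate. -/
def testCandidate : LoopProg :=
  assign 8 (.const 0) ;;
  loop 5 .objects
    (cond (.and (.not (.lt (.get 2 (.const 0) (.var 5)) (.var 0)))
        (.and (.not (.lt (.get 0 (.const 0) (.var 5)) (.var 3)))
          (.not (.lt (.var 3) (.get 0 (.const 0) (.var 5))))))
      (assign 8 (.const 1)))

/-- Copies row `j` of array `b` to row `i` of array `a`. -/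
def copyRow (a : ℕ) (i : Expr) (b : ℕ) (j : Expr) : LoopProg :=
  loop 6 .objects (store a i (.var 6) (.get b j (.var 6)))

/-- Row `0` of array `6` becomes the tally of row `0` of array `a`. -/
def tallyRow (a : ℕ) : LoopProg :=
  loop 4 .agents (store 6 (.const 0) (.var 4) (.const 0)) ;;
  loop 5 .objects
    (cond (.lt (.get a (.const 0) (.var 5)) (.var 0))
      (store 6 (.const 0) (.get a (.const 0) (.var 5))
        (.add (.get 6 (.const 0) (.get a (.const 0) (.var 5))) (.const 1))))

/-- Distributes the objects that row `0` of array `9` leaves to nobody, so that each agent gets as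
many objects as in row `0` of array `0`. -/
def distribute : LoopProg :=
  tallyRow 0 ;;
  loop 5 .objects
    (cond (.lt (.get 9 (.const 0) (.var 5)) (.var 0))
      (store 6 (.const 0) (.get 9 (.const 0) (.var 5))
        (.sub (.get 6 (.const 0) (.get 9 (.const 0) (.var 5))) (.const 1)))) ;;
  loop 5 .objects
    (cond (.not (.lt (.get 9 (.const 0) (.var 5)) (.var 0)))
      (loop 4 .agents
        (cond (.lt (.const 0) (.get 6 (.const 0) (.var 4))) (assign 6 (.var 4))) ;;
      store 9 (.const 0) (.var 5) (.var 6) ;;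
      store 6 (.const 0) (.var 6) (.sub (.get 6 (.const 0) (.var 6)) (.const 1))))

section Basic

variable {F : Solver} {n m : ℕ} {u : Utility n m}

theorem exec_topTable {α : ℝ} (hα : ∀ l o, u l o = α ↔ ∀ l' o', u l' o' ≤ u l o) {σ : State}
    (hn : σ.vars 0 = n) (hm : σ.vars 1 = m) : ∀ l < n, ∀ o < m,
      (0 < (topTable.exec F u σ).arrs 1 l o ↔ TopFor u α l o) := by
  set σ₁ := (assign 11 (.const 0)).exec F u ((assign 10 (.const 0)).exec F u σ) with hσ₁
  have hn₁ : σ₁.vars 0 = n := hn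
  have hm₁ : σ₁.vars 1 = m := hm
  have h1 := loop_loop_induction (F := F) (u := u) (x := 4) (y := 5) (r := .agents)
    (s := .objects)
    (P := (cond (.utilLt (.var 10) (.var 11) (.var 4) (.var 5))
      (assign 10 (.var 4) ;; assign 11 (.var 5)))) (σ := σ₁) (by decide) (by decide) (by decide)
    (by decide) (by decide) rfl rfl rfl
    -- Variables 10 and 11 point at the largest utility seen so far. Without agents or objects the
    -- initial position `(0, 0)` lies outside the table, hence the two premises.
    (fun D τ => (0 < n → 0 < m → τ.vars 10 < n ∧ τ.vars 11 < m) ∧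
      ∀ a < n, ∀ b < m, D a b →
        utilTable u a b ≤ utilTable u (τ.vars 10) (τ.vars 11))
    ⟨fun h h' => ⟨h, h'⟩, by simp⟩
    (fun D τ k h => by simpa [State.setVar] using h)
    (fun D τ k h => by simpa [State.setVar] using h) ?_
  swap
  · intro D k hk l hl τ hv ha hx hy hI
    simp only [LoopRange.size, hn₁, hm₁] at hk hl
    simp only [exec, Test.Holds, Expr.eval, hx, hy]
    split_ifs with h
    · simp only [State.setVar, Function.update_self, ne_eq, hy, Function.update_of_ne,
        not_false_eq_true, Nat.reduceEqDiff]
      refine ⟨fun _ _ => ⟨hk, hl⟩, ?_⟩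
      rintro a ha b hb (hD | ⟨rfl, rfl⟩)
      · exact (hI.2 a ha b hb hD).trans h.le
      · exact le_rfl
    · refine ⟨hI.1, ?_⟩
      rintro a ha b hb (hD | ⟨rfl, rfl⟩)
      · exact hI.2 a ha b hb hD
      · exact not_lt.1 h
  set σ₂ := (loop 4 .agents (loop 5 .objects
    (cond (.utilLt (.var 10) (.var 11) (.var 4) (.var 5))
      (assign 10 (.var 4) ;; assign 11 (.var 5))))).exec F u σ₁ with hσ₂
  have hn₂ : σ₂.vars 0 = n := (exec_vars rfl σ₁).trans hn₁
  have hm₂ : σ₂.vars 1 = m := (exec_vars rfl σ₁).trans hm₁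
  have h2 := loop_loop_induction (F := F) (u := u) (x := 4) (y := 5) (r := .agents)
    (s := .objects)
    (P := (store 1 (.var 4) (.var 5) (.const 1) ;;
      cond (.utilLt (.var 4) (.var 5) (.var 10) (.var 11))
        (store 1 (.var 4) (.var 5) (.const 0)))) (σ := σ₂) (by decide) (by decide) (by decide)
    (by decide) (by decide) rfl rfl rfl
    (fun D τ => ∀ a < n, ∀ b < m, D a b → (0 < τ.arrs 1 a b ↔
      ¬ utilTable u a b < utilTable u (σ₂.vars 10) (σ₂.vars 11)))
    (by simp) (fun D τ k h => h) (fun D τ k h => h) ?_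
  · intro l hl o ho
    have hlo : l < LoopRange.size σ₂ .agents ∧ o < LoopRange.size σ₂ .objects := by
      simpa only [LoopRange.size, hn₂, hm₂] using And.intro hl ho
    have hmax := h1.1 (Nat.zero_lt_of_lt hl) (Nat.zero_lt_of_lt ho)
    have hval : ∀ a (ha : a < n) b (hb : b < m), utilTable u a b = u ⟨a, ha⟩ ⟨b, hb⟩ :=
      fun a ha b hb => by simp [utilTable, ha, hb]
    have h1' := h1.2
    simp only [hval _ hmax.1 _ hmax.2] at h1'
    refine (h2 l hl o ho hlo).trans ?_
    rw [topFor_val (u := u) (α := α) ⟨l, hl⟩ ⟨o, ho⟩, hα, hval l hl o ho,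
      hval _ hmax.1 _ hmax.2, not_lt]
    refine ⟨fun h l' o' => ?_, fun h => h _ _⟩
    have := h1' l' l'.2 o' o'.2 (by
      simp only [LoopRange.size, hn₁, hm₁]; exact ⟨l'.2, o'.2⟩)
    rw [hval _ l'.2 _ o'.2] at this
    exact this.trans h
  · intro D k hk l hl τ hv ha hx hy hI a hak b hbl hD
    have h10 : τ.vars 10 = σ₂.vars 10 := hv 10 rfl
    have h11 : τ.vars 11 = σ₂.vars 11 := hv 11 rfl
    simp only [exec, Test.Holds, Expr.eval, State.setArr, hx, hy, h10, h11]
    by_cases hab : a = k ∧ b = l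
    · obtain ⟨rfl, rfl⟩ := hab
      split_ifs with h <;> simp [h]
    · have := hI a hak b hbl (hD.resolve_right hab)
      split_ifs <;> simpa [hab] using this

/-- The row indices are evaluated anew in each round, so `hi` asks for their values in every state
that differs from `σ` only in the counter and in array `a`. Copying within one array is allowed
between different rows. -/
theorem exec_copyRow {a b : ℕ} {i j : Expr} {I J : ℕ} {σ : State} (hm : σ.vars 1 = m)
    (hi : ∀ τ : State, (∀ y, y ≠ 6 → τ.vars y = σ.vars y) →
      (∀ c, c ≠ a → τ.arrs c = σ.arrs c) → i.eval τ = I ∧ j.eval τ = J)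
    (hne : ¬ (b = a ∧ J = I)) :
    (∀ o < m, ((copyRow a i b j).exec F u σ).arrs a I o = σ.arrs b J o) ∧
      ∀ x ≠ I, ((copyRow a i b j).exec F u σ).arrs a x = σ.arrs a x := by
  have h := loop_induction (F := F) (u := u) (x := 6) (r := .objects)
    (P := store a i (.var 6) (.get b j (.var 6))) (σ := σ)
    (fun k τ => (∀ o < k, τ.arrs a I o = σ.arrs b J o) ∧ ∀ x ≠ I, τ.arrs a x = σ.arrs a x)
    ⟨by simp, fun _ _ => rfl⟩ ?_
  · simp only [LoopRange.size, hm] at h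
    exact h
  · intro k hk τ hv ha hx hI
    obtain ⟨hiτ, hjτ⟩ := hi τ (fun y hy => hv y (by simpa [writesVar] using hy.symm))
      (fun c hc => ha c (by simpa [writesArr] using hc.symm))
    have hb : τ.arrs b J = σ.arrs b J := by
      by_cases hba : b = a
      · subst hba
        exact hI.2 J fun h => hne ⟨rfl, h⟩
      · rw [ha b (by simpa [writesArr] using fun h => hba h.symm)]
    simp only [exec, Expr.eval, State.setVar, State.setArr, hiτ, hjτ, hx, hb]
    refine ⟨fun o ho => ?_, fun x hxI => ?_⟩
    · split_ifs with h
      · rw [h.2.2]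
      · exact hI.1 o (lt_of_le_of_ne (Nat.lt_succ_iff.1 ho) fun h' => h (by simp [h']))
    · funext o
      rw [if_neg fun h => hxI h.2.1, hI.2 x hxI]

theorem exec_tallyRow {a : ℕ} (ha6 : a ≠ 6) {σ : State} (hn : σ.vars 0 = n) (hm : σ.vars 1 = m)
    {x : ℕ} (hx : x < n) :
    ((tallyRow a).exec F u σ).arrs 6 0 x = tally m (σ.arrs a 0) x := by
  have h1 := loop_induction (F := F) (u := u) (x := 4) (r := .agents)
    (P := store 6 (.const 0) (.var 4) (.const 0)) (σ := σ)
    (fun k τ => ∀ x < k, τ.arrs 6 0 x = 0) (by simp) ?_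
  swap
  · intro k hk τ hv ha hxk hI x hx
    simp only [exec, Expr.eval, State.setVar, State.setArr, hxk]
    split_ifs with h
    · rfl
    · exact hI x (lt_of_le_of_ne (Nat.lt_succ_iff.1 hx) fun h' => h (by simp [h']))
  set σ₁ := (loop 4 .agents (store 6 (.const 0) (.var 4) (.const 0))).exec F u σ with hσ₁
  have hn₁ : σ₁.vars 0 = n := (exec_vars rfl σ).trans hn
  have hm₁ : σ₁.vars 1 = m := (exec_vars rfl σ).trans hm
  have ha₁ : σ₁.arrs a = σ.arrs a := exec_arrs (by simpa [writesArr] using ha6.symm) σ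
  have h2 := loop_induction (F := F) (u := u) (x := 5) (r := .objects)
    (P := cond (.lt (.get a (.const 0) (.var 5)) (.var 0))
      (store 6 (.const 0) (.get a (.const 0) (.var 5))
        (.add (.get 6 (.const 0) (.get a (.const 0) (.var 5))) (.const 1)))) (σ := σ₁)
    (fun k τ => ∀ x < n, τ.arrs 6 0 x = tally k (σ.arrs a 0) x) ?_ ?_
  · simp only [LoopRange.size, hm₁] at h2
    exact h2 x hx
  · intro x hx
    exact h1 x (by simpa only [LoopRange.size, hn] using hx)
  · intro k hk τ hv ha hxk hI x hx
    have haτ : τ.arrs a = σ.arrs a := (ha a (by simpa [writesArr] using ha6.symm)).trans ha₁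
    have hnτ : τ.vars 0 = n := (hv 0 rfl).trans hn₁
    simp only [exec, Test.Holds, Expr.eval, hxk, hnτ, haτ]
    rw [tally_succ]
    split_ifs with h1 h2 h2
    · simp [State.setVar, State.setArr, h2, hI x hx]
    · simp [State.setVar, State.setArr, Ne.symm h2, hI x hx]
    · omega
    · exact hI x hx

/-- Row 0 of array 6 holds the room left in each bundle: objects held plus room equals the size in
`p`. The sizes add up to `m`, so an unassigned object always finds room. -/
theorem exec_distribute {p : ℕ → ℕ} (hp : ∀ o < m, p o < n) {σ : State} (hn : σ.vars 0 = n)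
    (hm : σ.vars 1 = m) (hσ : ∀ o < m, σ.arrs 0 0 o = p o)
    (hle : ∀ x < n, tally m (σ.arrs 9 0) x ≤ tally m p x) :
    let q := (distribute.exec F u σ).arrs 9 0
    (∀ o < m, q o < n) ∧ (∀ o < m, σ.arrs 9 0 o < n → q o = σ.arrs 9 0 o) ∧
      ∀ x < n, tally m q x = tally m p x := by
  set σ₁ := (tallyRow 0).exec F u σ with hσ₁
  have hn₁ : σ₁.vars 0 = n := (exec_vars rfl σ).trans hn
  have hm₁ : σ₁.vars 1 = m := (exec_vars rfl σ).trans hm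
  have h9₁ : σ₁.arrs 9 = σ.arrs 9 := exec_arrs rfl σ
  have h6₁ : ∀ x < n, σ₁.arrs 6 0 x = tally m p x := fun x hx => by
    rw [exec_tallyRow (by decide) hn hm hx, tally_congr hσ]
  have h2 := loop_induction (F := F) (u := u) (x := 5) (r := .objects)
    (P := cond (.lt (.get 9 (.const 0) (.var 5)) (.var 0))
      (store 6 (.const 0) (.get 9 (.const 0) (.var 5))
        (.sub (.get 6 (.const 0) (.get 9 (.const 0) (.var 5))) (.const 1)))) (σ := σ₁)
    (fun k τ => ∀ x < n, τ.arrs 6 0 x = tally m p x - tally k (σ.arrs 9 0) x)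
    (fun x hx => (h6₁ x hx).trans (Nat.sub_zero _).symm) ?_
  swap
  · intro k hk τ hv ha hxk hI x hx
    have haτ : τ.arrs 9 = σ.arrs 9 := (ha 9 rfl).trans h9₁
    have hnτ : τ.vars 0 = n := (hv 0 rfl).trans hn₁
    simp only [exec, Test.Holds, Expr.eval, hxk, hnτ, haτ]
    rw [tally_succ]
    split_ifs with h1 h2 h2
    · simp [State.setVar, State.setArr, h2, hI x hx, Nat.sub_sub]
    · simp [State.setVar, State.setArr, Ne.symm h2, hI x hx]
    · omega
    · exact hI x hx
  set σ₂ := (loop 5 .objects (cond (.lt (.get 9 (.const 0) (.var 5)) (.var 0))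
      (store 6 (.const 0) (.get 9 (.const 0) (.var 5))
        (.sub (.get 6 (.const 0) (.get 9 (.const 0) (.var 5))) (.const 1))))).exec F u σ₁ with hσ₂
  have hn₂ : σ₂.vars 0 = n := (exec_vars rfl σ₁).trans hn₁
  have hm₂ : σ₂.vars 1 = m := (exec_vars rfl σ₁).trans hm₁
  have h9₂ : σ₂.arrs 9 = σ.arrs 9 := (exec_arrs rfl σ₁).trans h9₁
  simp only [LoopRange.size, hm₁] at h2
  have htotal : ∑ x ∈ Finset.range n, tally m p x = m := by
    rw [sum_tally, Finset.sum_congr rfl fun o ho =>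
      if_pos (Finset.mem_range.2 (hp o (Finset.mem_range.1 ho)))]
    simp
  have h3 := loop_induction (F := F) (u := u) (x := 5) (r := .objects)
    (P := cond (.not (.lt (.get 9 (.const 0) (.var 5)) (.var 0)))
      (loop 4 .agents
        (cond (.lt (.const 0) (.get 6 (.const 0) (.var 4))) (assign 6 (.var 4))) ;;
      store 9 (.const 0) (.var 5) (.var 6) ;;
      store 6 (.const 0) (.var 6) (.sub (.get 6 (.const 0) (.var 6)) (.const 1)))) (σ := σ₂)
    (fun k τ => (∀ o < k, τ.arrs 9 0 o < n) ∧
      (∀ o < m, σ.arrs 9 0 o < n → τ.arrs 9 0 o = σ.arrs 9 0 o) ∧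
      ∀ x < n, tally m (τ.arrs 9 0) x + τ.arrs 6 0 x = tally m p x)
    ⟨by simp, fun o _ _ => congrFun (congrFun h9₂ 0) o, fun x hx => ?_⟩ ?_
  · simp only [LoopRange.size, hm₂] at h3
    refine ⟨h3.1, h3.2.1, ?_⟩
    have h1 : ∀ o < m, (distribute.exec F u σ).arrs 9 0 o < n := h3.1
    -- No bundle is too large, and all `m` objects are assigned, so every bundle has exactly its old
    -- size.
    have hle : ∀ x ∈ Finset.range n, tally m ((distribute.exec F u σ).arrs 9 0) x ≤ tally m p x :=
      fun x hx => Nat.le_of_add_right_le (h3.2.2 x (Finset.mem_range.1 hx)).le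
    have hsum : ∑ x ∈ Finset.range n, tally m ((distribute.exec F u σ).arrs 9 0) x =
        ∑ x ∈ Finset.range n, tally m p x := by
      rw [htotal, sum_tally, Finset.sum_congr rfl fun o ho =>
        if_pos (Finset.mem_range.2 (h1 o (Finset.mem_range.1 ho)))]
      simp
    exact fun x hx => (Finset.sum_eq_sum_iff_of_le hle).1 hsum x (Finset.mem_range.2 hx)
  · have h6 : σ₂.arrs 6 0 x = tally m p x - tally m (σ.arrs 9 0) x := h2 x hx
    have := hle x hx
    simp only [State.setVar, h9₂]
    omega
  · intro k hk τ hv ha hxk ⟨hI1, hI2, hI3⟩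
    simp only [LoopRange.size, hm₂] at hk
    have hnτ : τ.vars 0 = n := (hv 0 rfl).trans hn₂
    by_cases hkn : τ.arrs 9 0 k < n
    · simp only [exec, Test.Holds, Expr.eval, hxk, hnτ, hkn, not_true_eq_false, if_false]
      refine ⟨fun o ho => ?_, hI2, hI3⟩
      rcases Nat.lt_succ_iff_lt_or_eq.1 ho with h | rfl
      · exact hI1 o h
      · exact hkn
    -- Without room the agents would hold `m` objects, although object `k` is with nobody.
    have hroom : ∃ x < n, 0 < τ.arrs 6 0 x := by
      by_contra! hno
      have h1 : ∑ x ∈ Finset.range n, tally m (τ.arrs 9 0) x = m := by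
        refine Eq.trans ?_ htotal
        refine Finset.sum_congr rfl fun x hx => ?_
        have h1 := hI3 x (Finset.mem_range.1 hx)
        rwa [Nat.le_zero.1 (hno x (Finset.mem_range.1 hx)), add_zero] at h1
      have h2 : ∑ x ∈ Finset.range n, tally m (τ.arrs 9 0) x < ∑ o ∈ Finset.range m, 1 := by
        rw [sum_tally]
        refine Finset.sum_lt_sum (fun o _ => by split_ifs <;> simp)
          ⟨k, Finset.mem_range.2 hk, ?_⟩
        rw [if_neg (by simpa using hkn)]
        exact zero_lt_one
      simp only [Finset.sum_const, Finset.card_range, smul_eq_mul, mul_one] at h2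
      omega
    have h4 := loop_induction (F := F) (u := u) (x := 4) (r := .agents)
      (P := cond (.lt (.const 0) (.get 6 (.const 0) (.var 4))) (assign 6 (.var 4))) (σ := τ)
      (fun k ρ => (∃ x < k, 0 < τ.arrs 6 0 x) → ρ.vars 6 < n ∧ 0 < τ.arrs 6 0 (ρ.vars 6))
      (by simp) ?_
    swap
    · intro j hj ρ hv' ha' hxj hI
      have h6 : ρ.arrs 6 = τ.arrs 6 := ha' 6 rfl
      simp only [LoopRange.size, hnτ] at hj
      simp only [exec, Test.Holds, Expr.eval, hxj, h6]
      split_ifs with h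
      · intro _
        simpa [State.setVar] using ⟨hj, h⟩
      · rintro ⟨x, hx, h'⟩
        rcases Nat.lt_succ_iff_lt_or_eq.1 hx with h'' | rfl
        · simpa [State.setVar] using hI ⟨x, h'', h'⟩
        · exact absurd h' h
    simp only [LoopRange.size, hnτ] at h4
    set ρ := (loop 4 .agents
      (cond (.lt (.const 0) (.get 6 (.const 0) (.var 4))) (assign 6 (.var 4)))).exec F u τ with hρ
    have hρ5 : ρ.vars 5 = k := (exec_vars rfl τ).trans hxk
    have hρ9 : ρ.arrs 9 = τ.arrs 9 := exec_arrs rfl τ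
    have hρ6 : ρ.arrs 6 = τ.arrs 6 := exec_arrs rfl τ
    obtain ⟨hy, hpos⟩ := h4 hroom
    rw [exec_cond_pos (by simpa [Test.Holds, Expr.eval, hxk, hnτ] using hkn), exec_seq,
      exec_seq, ← hρ]
    simp only [exec_store, Expr.eval, State.setVar, State.setArr, hρ5, hρ6, hρ9,
      false_and, if_false, true_and, Nat.reduceEqDiff]
    generalize ρ.vars 6 = y at hy hpos
    have h9 : (fun o => if o = k then y else τ.arrs 9 0 o) =
        Function.update (τ.arrs 9 0) k y := by
      funext o
      simp [Function.update_apply]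
    simp only [congrFun h9]
    refine ⟨fun o ho => ?_, fun o ho hM => ?_, fun x hx => ?_⟩
    · rcases eq_or_ne o k with rfl | hne
      · simpa using hy
      · simpa [hne] using hI1 o (by omega)
    · rw [Function.update_of_ne, hI2 o ho hM]
      rintro rfl
      rw [hI2 _ ho hM] at hkn
      exact hkn hM
    · have h1 := tally_update hk (τ.arrs 9 0) y x
      have h2 := hI3 x hx
      rw [if_neg (by rintro rfl; exact hkn hx)] at h1
      change tally m (fun o => Function.update (τ.arrs 9 0) k y o) x + _ = _ at h1
      by_cases hxy : x = y
      · subst hxy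
        simp only [if_true] at h1 ⊢
        omega
      · simp only [hxy, Ne.symm hxy, if_false] at h1 ⊢
        omega

end Basic

/-! ## The search for an additional top object -/

/-- If the agent in variable `4` is visited, values the object in variable `5` most, and the owner
of this object is not visited, then the owner becomes visited. -/
def visit : LoopProg :=
  cond (.and (.lt (.const 0) (.get 3 (.const 0) (.var 4)))
      (.and (.lt (.const 0) (.get 1 (.var 4) (.var 5)))
        (.not (.lt (.const 0) (.get 3 (.const 0) (.get 2 (.const 0) (.var 5)))))))
    (copyRow 4 (.get 2 (.const 0) (.var 5)) 4 (.var 4) ;;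
      store 4 (.get 2 (.const 0) (.var 5)) (.var 5) (.var 4) ;;
      store 3 (.const 0) (.get 2 (.const 0) (.var 5)) (.const 1))

/-- Searches for a way to give one more top object to the agent in variable `3`. Variable `9` tells
whether there is one, and row `0` of array `9` shows it. -/
def search : LoopProg :=
  -- The range `.vertices` includes the index `n`, which stands for nobody and must be unmarked as
  -- well.
  loop 4 .vertices (store 3 (.const 0) (.var 4) (.const 0)) ;;
  store 3 (.const 0) (.var 3) (.const 1) ;;
  copyRow 4 (.var 3) 2 (.const 0) ;;
  -- The visited set starts with one element, has at most `n + 1`, and grows in every round until it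
  -- is exhausted: `n` rounds suffice.
  loop 7 .agents (loop 4 .agents (loop 5 .objects visit)) ;;
  assign 9 (.get 3 (.const 0) (.var 0)) ;;
  copyRow 9 (.const 0) 4 (.var 0)

section Search

variable {F : Solver} {n m : ℕ} {u : Utility n m} {W : ℕ → ℕ → Prop} {p : ℕ → ℕ}

/-- The input and the tables computed from it are in place. -/
structure Ready (n m : ℕ) (W : ℕ → ℕ → Prop) (p : ℕ → ℕ) (σ : State) : Prop where
  agents : σ.vars 0 = n
  objects : σ.vars 1 = m
  owner : ∀ o < m, σ.arrs 0 0 o = p o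
  top : ∀ l < n, ∀ o < m, (0 < σ.arrs 1 l o ↔ W l o)
  part : ∀ o < m, σ.arrs 2 0 o = topPart n W p o

theorem Ready.congr {σ τ : State} (h : Ready n m W p σ) (h0 : τ.vars 0 = σ.vars 0)
    (h1 : τ.vars 1 = σ.vars 1) (ha0 : τ.arrs 0 = σ.arrs 0) (ha1 : τ.arrs 1 = σ.arrs 1)
    (ha2 : τ.arrs 2 = σ.arrs 2) : Ready n m W p τ where
  agents := h0.trans h.agents
  objects := h1.trans h.objects
  owner := by rw [ha0]; exact h.owner
  top := by rw [ha1]; exact h.top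
  part := by rw [ha2]; exact h.part

theorem Ready.exec {σ : State} (h : Ready n m W p σ) {P : LoopProg}
    (h0 : P.writesVar 0 = false) (h1 : P.writesVar 1 = false) (ha0 : P.writesArr 0 = false)
    (ha1 : P.writesArr 1 = false) (ha2 : P.writesArr 2 = false) :
    Ready n m W p (P.exec F u σ) :=
  h.congr (exec_vars h0 σ) (exec_vars h1 σ) (exec_arrs ha0 σ) (exec_arrs ha1 σ)
    (exec_arrs ha2 σ)

theorem exec_findTopPart (hp : ∀ o < m, p o < n) {σ : State} (hn : σ.vars 0 = n)
    (hm : σ.vars 1 = m) (hσ : ∀ o < m, σ.arrs 0 0 o = p o)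
    (hW : ∀ l < n, ∀ o < m, (0 < σ.arrs 1 l o ↔ W l o)) :
    Ready n m W p (findTopPart.exec F u σ) := by
  have h := loop_induction (F := F) (u := u) (x := 5) (r := .objects)
    (P := store 2 (.const 0) (.var 5) (.var 0) ;;
      cond (.lt (.const 0) (.get 1 (.get 0 (.const 0) (.var 5)) (.var 5)))
        (store 2 (.const 0) (.var 5) (.get 0 (.const 0) (.var 5)))) (σ := σ)
    (fun k τ => ∀ o < k, τ.arrs 2 0 o = topPart n W p o) (by simp) ?_
  · simp only [LoopRange.size, hm] at h
    exact ⟨(exec_vars rfl σ).trans hn, (exec_vars rfl σ).trans hm,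
      by rw [exec_arrs rfl σ]; exact hσ, by rw [exec_arrs rfl σ]; exact hW, h⟩
  · intro k hk τ hv ha hxk hI o ho
    simp only [LoopRange.size, hm] at hk
    have h0 : τ.arrs 0 = σ.arrs 0 := ha 0 rfl
    have h1 : τ.arrs 1 = σ.arrs 1 := ha 1 rfl
    have hnτ : τ.vars 0 = n := (hv 0 rfl).trans hn
    simp only [LoopProg.exec, Test.Holds, Expr.eval, State.setVar, State.setArr, hxk, h0, h1,
      hσ k hk, hnτ]
    rcases Nat.lt_succ_iff_lt_or_eq.1 ho with ho' | rfl
    · split_ifs <;> simp [ho'.ne, hI o ho']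
    · have := hW (p o) (hp o hk) o hk
      by_cases hWo : W (p o) o
      · simp [this.2 hWo, topPart, hWo]
      · have h' : σ.arrs 1 (p o) o = 0 := by
          rw [← this] at hWo
          omega
        simp [topPart, hWo, h']

theorem exec_testCandidate (hp : ∀ o < m, p o < n) {σ : State} (hσ : Ready n m W p σ) :
    0 < (testCandidate.exec F u σ).vars 8 ↔ Candidate m W p (σ.vars 3) := by
  have h := loop_induction (F := F) (u := u) (x := 5) (r := .objects)
    (P := cond (.and (.not (.lt (.get 2 (.const 0) (.var 5)) (.var 0)))
        (.and (.not (.lt (.get 0 (.const 0) (.var 5)) (.var 3)))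
          (.not (.lt (.var 3) (.get 0 (.const 0) (.var 5))))))
      (assign 8 (.const 1))) (σ := (assign 8 (.const 0)).exec F u σ)
    (fun k τ => 0 < τ.vars 8 ↔ ∃ o < k, p o = σ.vars 3 ∧ ¬ topPart n W p o < n)
    (by simp [exec_assign, State.setVar, Expr.eval]) ?_
  · have hm : ((assign 8 (.const 0)).exec F u σ).vars 1 = m := hσ.objects
    simp only [LoopRange.size, hm] at h
    rw [candidate_iff hp]
    exact h
  · intro k hk τ hv ha hxk hI
    have hkm : k < m := lt_of_lt_of_eq hk hσ.objects
    have h0 : τ.arrs 0 = σ.arrs 0 := ha 0 rfl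
    have h2 : τ.arrs 2 = σ.arrs 2 := ha 2 rfl
    have h3 : τ.vars 3 = σ.vars 3 := hv 3 rfl
    have hnτ : τ.vars 0 = n := (hv 0 rfl).trans hσ.agents
    have hiff : (∃ o < k + 1, p o = σ.vars 3 ∧ ¬ topPart n W p o < n) ↔
        (∃ o < k, p o = σ.vars 3 ∧ ¬ topPart n W p o < n) ∨
          p k = σ.vars 3 ∧ ¬ topPart n W p k < n := by
      constructor
      · rintro ⟨o, ho, h⟩
        rcases Nat.lt_succ_iff_lt_or_eq.1 ho with ho | rfl
        · exact Or.inl ⟨o, ho, h⟩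
        · exact Or.inr h
      · rintro (⟨o, ho, h⟩ | h)
        · exact ⟨o, by omega, h⟩
        · exact ⟨k, by omega, h⟩
    rw [hiff, ← hI]
    simp only [LoopProg.exec, Test.Holds, Expr.eval, hxk, h0, h2, h3, hnτ, hσ.owner k hkm,
      hσ.part k hkm]
    split_ifs with h
    · refine iff_of_true (by simp [State.setVar]) (Or.inr ⟨by omega, h.1⟩)
    · have : ¬ (p k = σ.vars 3 ∧ ¬ topPart n W p k < n) := fun h' =>
        h ⟨h'.2, by rw [h'.1]; exact lt_irrefl _, by rw [h'.1]; exact lt_irrefl _⟩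
      simp only [State.setVar, ne_eq, Nat.reduceEqDiff, not_false_eq_true, Function.update_of_ne,
        this, or_false]

/-- Array `3` shows the set `V`, and array `4` the rows of the search. -/
structure Searching (n m : ℕ) (W : ℕ → ℕ → Prop) (p : ℕ → ℕ) (i : ℕ) (V : Finset ℕ)
    (σ : State) : Prop where
  visited : ∀ l ≤ n, (0 < σ.arrs 3 0 l ↔ l ∈ V)
  le : ∀ l ∈ V, l ≤ n
  rows : Search n m W p i V (σ.arrs 4)

/-- No further agent can be visited. -/
def Exhausted (n m : ℕ) (W : ℕ → ℕ → Prop) (p : ℕ → ℕ) (V : Finset ℕ) : Prop :=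
  ∀ l < n, ∀ o < m, l ∈ V → W l o → topPart n W p o ∈ V

variable {i : ℕ}

theorem Searching.congr {V : Finset ℕ} {σ τ : State} (h : Searching n m W p i V σ)
    (h3 : τ.arrs 3 = σ.arrs 3) (h4 : τ.arrs 4 = σ.arrs 4) : Searching n m W p i V τ :=
  ⟨by rw [h3]; exact h.visited, h.le, by rw [h4]; exact h.rows⟩

/-- Either `Search.insert` applies or nothing changes. The last two clauses are what a whole round
needs: an exhausted set stays as it is, and an unchanged set has no exchange leading out along this
pair. -/
theorem exec_visit (hp : ∀ o < m, p o < n) {σ : State} (hσ : Ready n m W p σ) {V : Finset ℕ}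
    (hV : Searching n m W p i V σ) {l o : ℕ} (hl : l < n) (ho : o < m) (h4 : σ.vars 4 = l)
    (h5 : σ.vars 5 = o) :
    ∃ V', Searching n m W p i V' (visit.exec F u σ) ∧ V ⊆ V' ∧
      (Exhausted n m W p V → V' = V) ∧ (V' = V → l ∈ V → W l o → topPart n W p o ∈ V) := by
  have hle := topPart_le (W := W) hp ho
  have hpart := hσ.part o ho
  by_cases hc : l ∈ V ∧ W l o ∧ topPart n W p o ∉ V
  · obtain ⟨hlV, hW, hne⟩ := hc
    refine ⟨insert (topPart n W p o) V, ?_, Finset.subset_insert _ _,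
      fun h => absurd (h l hl o ho hlV hW) hne, fun h => absurd ?_ hne⟩
    swap
    · rw [← h]; exact Finset.mem_insert_self _ _
    rw [visit, exec_cond_pos]
    swap
    · simp only [Test.Holds, Expr.eval, h4, h5, hpart, hV.visited l hl.le, hσ.top l hl o ho,
        hV.visited _ hle]
      exact ⟨hlV, hW, hne⟩
    have hcopy := exec_copyRow (F := F) (u := u) (a := 4) (b := 4)
      (i := .get 2 (.const 0) (.var 5)) (j := .var 4) (I := topPart n W p o) (J := l)
      hσ.objects (fun τ hv ha => by
        simp only [Expr.eval, hv 5 (by decide), ha 2 (by decide), hv 4 (by decide), h4, h5, hpart,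
          and_self]) (by rintro ⟨-, rfl⟩; exact hne hlV)
    rw [exec_seq, exec_seq]
    set ρ := (copyRow 4 (.get 2 (.const 0) (.var 5)) 4 (.var 4)).exec F u σ with hρ
    have hρ4 : ρ.vars 4 = l := (exec_vars rfl σ).trans h4
    have hρ5 : ρ.vars 5 = o := (exec_vars rfl σ).trans h5
    have hρa2 : ρ.arrs 2 0 o = topPart n W p o := by rw [hρ, exec_arrs rfl σ]; exact hpart
    have hρa3 : ρ.arrs 3 = σ.arrs 3 := exec_arrs rfl σ
    simp only [exec_store, Expr.eval, State.setArr, hρ4, hρ5, hρa2, Nat.reduceEqDiff,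
      false_and, if_false]
    refine ⟨fun x hx => ?_, fun x hx => ?_, hV.rows.insert hlV ho hW hne (fun x hx o' ho' => ?_)
      fun o' ho' => ?_⟩
    · rw [Finset.mem_insert]
      by_cases h : x = topPart n W p o
      · simp [h]
      · simpa [h, hρa3] using hV.visited x hx
    · rcases Finset.mem_insert.1 hx with rfl | hx
      · exact hle
      · exact hV.le x hx
    · have hxne : x ≠ topPart n W p o := by rintro rfl; exact hne hx
      simp [hxne, hcopy.2 x hxne]
    · simp [Function.update_apply, hcopy.1 o' ho']
  · refine ⟨V, ?_, subset_rfl, fun _ => rfl, fun _ hlV hW => ?_⟩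
    · rw [visit, exec_cond_neg]
      · exact hV
      · simpa only [Test.Holds, Expr.eval, h4, h5, hpart, hV.visited l hl.le, hσ.top l hl o ho,
          hV.visited _ hle] using hc
    · by_contra hne
      exact hc ⟨hlV, hW, hne⟩

/-- A round that leaves `V` unchanged has tried all pairs in vain, so a round makes progress unless
the search is over. -/
theorem exec_search_round (hp : ∀ o < m, p o < n) {σ : State} (hσ : Ready n m W p σ)
    {V : Finset ℕ} (hV : Searching n m W p i V σ) :
    ∃ V', Searching n m W p i V' ((loop 4 .agents (loop 5 .objects visit)).exec F u σ) ∧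
      (Exhausted n m W p V → V' = V) ∧ V ⊆ V' ∧ (V' = V → Exhausted n m W p V) := by
  have h := loop_loop_induction (F := F) (u := u) (x := 4) (y := 5) (r := .agents)
    (s := .objects) (P := visit) (σ := σ) (by decide) (by decide) (by decide) (by decide)
    (by decide) rfl rfl rfl
    (fun D τ => ∃ V', Searching n m W p i V' τ ∧ (Exhausted n m W p V → V' = V) ∧ V ⊆ V' ∧
      (V' = V → ∀ l < n, ∀ o < m, D l o → l ∈ V → W l o → topPart n W p o ∈ V))
    ⟨V, hV, fun _ => rfl, subset_rfl, by simp⟩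
    (fun D τ k ⟨V', h⟩ => ⟨V', h.1.congr rfl rfl, h.2⟩)
    (fun D τ k ⟨V', h⟩ => ⟨V', h.1.congr rfl rfl, h.2⟩) ?_
  · obtain ⟨V', h1, h2, h3, h4⟩ := h
    refine ⟨V', h1, h2, h3, fun hVV l hl o ho => h4 hVV l hl o ho ?_⟩
    simp only [LoopRange.size, hσ.agents, hσ.objects]
    exact ⟨hl, ho⟩
  · rintro D k hk l hl τ hv ha hx hy ⟨V', hV', hE, hsub, hD⟩
    simp only [LoopRange.size, hσ.agents, hσ.objects] at hk hl
    have hτ : Ready n m W p τ := hσ.congr (hv 0 rfl) (hv 1 rfl) (ha 0 rfl) (ha 1 rfl) (ha 2 rfl)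
    obtain ⟨V'', hV'', hsub', hE', hlast⟩ := exec_visit (F := F) (u := u) hp hτ hV' hk hl hx hy
    refine ⟨V'', hV'', fun h => ?_, hsub.trans hsub', fun h => ?_⟩
    · have h' := hE h
      rw [hE' (by rwa [h']), h']
    · subst h
      have h' : V' = V'' := subset_antisymm hsub' hsub
      subst h'
      rintro a ha' b hb (h | ⟨rfl, rfl⟩)
      · exact hD rfl a ha' b hb h
      · exact hlast rfl

/-- The final set `V` is exhausted. If it contains `n`, row `n` is an augmentation; if not, `V` is a
closed set of agents containing `i`, and Hall's counting argument excludes any augmentation. -/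
theorem exec_search (hp : ∀ o < m, p o < n) {σ : State} (hσ : Ready n m W p σ) (hi : i < n)
    (h3 : σ.vars 3 = i) :
    (0 < (search.exec F u σ).vars 9 → Augments n m W p i ((search.exec F u σ).arrs 9 0)) ∧
      (¬ 0 < (search.exec F u σ).vars 9 → ∀ M, ¬ Augments n m W p i M) := by
  have hinit := loop_induction (F := F) (u := u) (x := 4) (r := .vertices)
    (P := store 3 (.const 0) (.var 4) (.const 0)) (σ := σ)
    (fun k τ => ∀ l < k, τ.arrs 3 0 l = 0) (by simp) ?_
  swap
  · intro k hk τ hv ha hxk hI x hx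
    simp only [exec_store, Expr.eval, State.setVar, State.setArr, hxk]
    split_ifs with h
    · rfl
    · exact hI x (lt_of_le_of_ne (Nat.lt_succ_iff.1 hx) fun h' => h (by simp [h']))
  simp only [LoopRange.size, hσ.agents] at hinit
  rw [search, exec_seq, exec_seq, exec_seq, exec_seq, exec_seq]
  set σ₁ := (loop 4 .vertices (store 3 (.const 0) (.var 4) (.const 0))).exec F u σ with hσ₁
  have hr₁ : Ready n m W p σ₁ := hσ.exec rfl rfl rfl rfl rfl
  have h3₁ : σ₁.vars 3 = i := (exec_vars rfl σ).trans h3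
  set σ₂ := (store 3 (.const 0) (.var 3) (.const 1)).exec F u σ₁ with hσ₂
  have hr₂ : Ready n m W p σ₂ := hr₁.exec rfl rfl rfl rfl rfl
  have h3₂ : σ₂.vars 3 = i := (exec_vars rfl σ₁).trans h3₁
  have ha₂ : ∀ l ≤ n, (0 < σ₂.arrs 3 0 l ↔ l = i) := by
    intro l hl
    simp only [hσ₂, exec_store, Expr.eval, State.setArr, h3₁, true_and]
    by_cases h : l = i
    · simp [h]
    · simp [h, hinit l (by omega)]
  have hcopy := exec_copyRow (F := F) (u := u) (a := 4) (b := 2) (i := .var 3) (j := .const 0)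
    (I := i) (J := 0) hr₂.objects
    (fun τ hv ha => ⟨(hv 3 (by decide)).trans h3₂, rfl⟩) (by simp)
  set σ₃ := (copyRow 4 (.var 3) 2 (.const 0)).exec F u σ₂ with hσ₃
  have hr₃ : Ready n m W p σ₃ := hr₂.exec rfl rfl rfl rfl rfl
  have hs₃ : Searching n m W p i {i} σ₃ := by
    refine ⟨fun l hl => ?_, fun l hl => ?_, Search.init fun o ho => ?_⟩
    · rw [hσ₃, exec_arrs rfl, ha₂ l hl, Finset.mem_singleton]
    · rw [Finset.mem_singleton.1 hl]; exact hi.le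
    · rw [hcopy.1 o ho]; exact hr₂.part o ho
  have hrounds := loop_induction (F := F) (u := u) (x := 7) (r := .agents)
    (P := loop 4 .agents (loop 5 .objects visit)) (σ := σ₃)
    (fun k τ => ∃ V, Searching n m W p i V τ ∧ (Exhausted n m W p V ∨ k < V.card))
    ⟨{i}, hs₃.congr rfl rfl, Or.inr (by simp)⟩ ?_
  swap
  · rintro k hk τ hv ha hxk ⟨V, hV, hcase⟩
    have hτ : Ready n m W p τ := hr₃.congr (hv 0 rfl) (hv 1 rfl) (ha 0 rfl) (ha 1 rfl) (ha 2 rfl)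
    obtain ⟨V', hV', h1, h2, h3⟩ := exec_search_round (F := F) (u := u) hp hτ hV
    refine ⟨V', hV'.congr rfl rfl, ?_⟩
    by_cases hVV : V' = V
    · rw [hVV]; exact Or.inl (h3 hVV)
    · have hlt := Finset.card_lt_card (lt_of_le_of_ne h2 (Ne.symm hVV))
      rcases hcase with h | h
      · exact absurd (h1 h) hVV
      · exact Or.inr (by omega)
  simp only [LoopRange.size, hr₃.agents] at hrounds
  obtain ⟨V, hV, hcase⟩ := hrounds
  have hE : Exhausted n m W p V := by
    -- With more than `n` elements `V` consists of all agents and nobody, and is trivially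
    -- exhausted.
    refine hcase.elim id fun hcard l _ o ho _ _ => ?_
    have hVn : V = Finset.range (n + 1) := Finset.eq_of_subset_of_card_le
      (fun l hl => Finset.mem_range.2 (Nat.lt_succ_iff.2 (hV.le l hl)))
      (by rw [Finset.card_range]; exact hcard)
    rw [hVn, Finset.mem_range]
    exact Nat.lt_succ_iff.2 (topPart_le hp ho)
  set σ₄ := (loop 7 .agents (loop 4 .agents (loop 5 .objects visit))).exec F u σ₃ with hσ₄
  have hr₄ : Ready n m W p σ₄ := hr₃.exec rfl rfl rfl rfl rfl
  set σ₅ := (assign 9 (.get 3 (.const 0) (.var 0))).exec F u σ₄ with hσ₅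
  have h9 : σ₅.vars 9 = σ₄.arrs 3 0 n := by
    simp [hσ₅, exec_assign, State.setVar, Expr.eval, hr₄.agents]
  have hr₅ : Ready n m W p σ₅ := hr₄.exec rfl rfl rfl rfl rfl
  have hcopy' := exec_copyRow (F := F) (u := u) (a := 9) (b := 4) (i := .const 0) (j := .var 0)
    (I := 0) (J := n) hr₅.objects
    (fun τ hv ha => ⟨rfl, (hv 0 (by decide)).trans hr₅.agents⟩) (by simp)
  rw [exec_vars (P := copyRow 9 (.const 0) 4 (.var 0)) (y := 9) rfl σ₅, h9,
    hV.visited n le_rfl]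
  refine ⟨fun h => ?_, fun h => ?_⟩
  · obtain ⟨h1, h2⟩ := hV.rows.augments h
    have h4 : ∀ o < m, ((copyRow 9 (.const 0) 4 (.var 0)).exec F u σ₅).arrs 9 0 o =
        σ₄.arrs 4 n o := hcopy'.1
    refine ⟨fun o ho hn => ?_, fun x hx => ?_⟩
    · rw [h4 o ho] at hn ⊢
      exact h1 o ho hn
    · rw [tally_congr h4, h2 x hx]
  · have hlt : ∀ l ∈ V, l < n := fun l hl => lt_of_le_of_ne (hV.le l hl) fun h' => h (h' ▸ hl)
    exact ClosedUnder.not_augments (s := V) (fun l hl o ho hW => hE l (hlt l hl) o ho hl hW) hlt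
      hV.rows.mem

end Search

/-! ## The improvement program -/

/-- Looks for a Pareto improvement. The subprogram `find` tries to give one more top object to the
candidate agent in variable `3`, see `Finds`. -/
def improve (find : LoopProg) : LoopProg :=
  topTable ;; findTopPart ;; assign 2 (.const 0) ;;
  loop 3 .agents
    (testCandidate ;;
      cond (.lt (.const 0) (.var 8))
        (find ;;
          cond (.lt (.const 0) (.var 9))
            -- The improvement is kept apart in array 5, since `p` is still needed for the remaining
            -- candidates; a later success overwrites it.
            (distribute ;; copyRow 5 (.const 0) 9 (.const 0) ;; assign 2 (.const 1)))) ;;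
  cond (.lt (.const 0) (.var 2)) (copyRow 0 (.const 0) 5 (.const 0))

/-- The program calls the solver. -/
def LoopProg.callsSolver : LoopProg → Bool
  | assign _ _ => false
  | store _ _ _ _ => false
  | seq P Q => P.callsSolver || Q.callsSolver
  | cond _ P => P.callsSolver
  | loop _ _ P => P.callsSolver
  | maxflow _ _ => true

theorem LoopProg.callFree_compile {P : LoopProg} (h : P.callsSolver = false) :
    P.compile.CallFree := by
  induction P with
  | assign | store => exact trivial
  | seq P Q hP hQ =>
    simp only [callsSolver, Bool.or_eq_false_iff] at h
    exact ⟨hP h.1, hQ h.2⟩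
  | cond b P hP => exact ⟨hP h, trivial⟩
  | loop x r P hP => exact ⟨trivial, hP h, trivial⟩
  | maxflow => simp [callsSolver] at h

section Improve

variable {F : Solver} {n m : ℕ} {u : Utility n m} {W : ℕ → ℕ → Prop} {p : ℕ → ℕ}

theorem LoopProg.queries_eq_nil {P : LoopProg} (h : P.callsSolver = false) (σ : State) :
    P.queries F u σ = [] := by
  induction P generalizing σ with
  | assign | store => rfl
  | seq P Q hP hQ =>
    simp only [callsSolver, Bool.or_eq_false_iff] at h
    simp [queries, hP h.1, hQ h.2]
  | cond b P hP => simp [queries, hP h]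
  | loop x r P hP => simp [queries, hP h]
  | maxflow => simp [callsSolver] at h

/-- The row `q` extends `M` and gives each agent as many objects as `p`. -/
def Completes (n m : ℕ) (p M q : ℕ → ℕ) : Prop :=
  (∀ o < m, q o < n) ∧ (∀ o < m, M o < n → q o = M o) ∧ ∀ x < n, tally m q x = tally m p x

/-- The program `find` decides in variable `9` whether the candidate agent in variable `3` can get
one more top object, and shows how in row `0` of array `9`. The relation `Acc` between the posed
networks and the candidates treated so far is maintained. -/
structure Finds (F : Solver) (u : Utility n m) (W : ℕ → ℕ → Prop) (p : ℕ → ℕ)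
    (Acc : List Query → List ℕ → Prop) (find : LoopProg) : Prop where
  vars : ∀ y ≤ 3, find.writesVar y = false
  arrs : ∀ a, a ≤ 2 ∨ a = 5 → find.writesArr a = false
  decides : ∀ τ i, Ready n m W p τ → i < n → τ.vars 3 = i →
    (0 < (find.exec F u τ).vars 9 → Augments n m W p i ((find.exec F u τ).arrs 9 0)) ∧
      (¬ 0 < (find.exec F u τ).vars 9 → ∀ M, ¬ Augments n m W p i M)
  acc : ∀ τ i, Ready n m W p τ → i < n → τ.vars 3 = i → ∀ qs cs, Acc qs cs →
    Acc (qs ++ find.queries F u τ) (cs ++ [i])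

/-- The state after the candidates in `cs` have been treated. -/
structure Treated (n m : ℕ) (W : ℕ → ℕ → Prop) (p : ℕ → ℕ) (k : ℕ)
    (Acc : List Query → List ℕ → Prop) (flag : ℕ) (q : ℕ → ℕ) (qs : List Query) : Prop where
  answer : (flag = 0 ∧ ∀ i < k, Candidate m W p i → ∀ M, ¬ Augments n m W p i M) ∨
    flag = 1 ∧ ∃ i < n, ∃ M, Augments n m W p i M ∧ Completes n m p M q
  record : ∃ cs : List ℕ, cs.Nodup ∧ (∀ i, i ∈ cs ↔ i < k ∧ Candidate m W p i) ∧ Acc qs cs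

theorem Treated.skip {Acc : List Query → List ℕ → Prop} {k flag : ℕ} {q : ℕ → ℕ}
    {qs : List Query} (h : Treated n m W p k Acc flag q qs) (hk : ¬ Candidate m W p k) :
    Treated n m W p (k + 1) Acc flag q qs where
  answer := h.answer.imp_left fun ⟨h1, h2⟩ => ⟨h1, fun i hi hc => by
    rcases Nat.lt_succ_iff_lt_or_eq.1 hi with hi | rfl
    · exact h2 i hi hc
    · exact absurd hc hk⟩
  record := by
    obtain ⟨cs, h1, h2, h3⟩ := h.record
    refine ⟨cs, h1, fun i => (h2 i).trans (and_congr_left fun hc => ?_), h3⟩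
    exact ⟨fun h => h.trans (Nat.lt_succ_self k), fun h => lt_of_le_of_ne (Nat.lt_succ_iff.1 h)
      (by rintro rfl; exact hk hc)⟩

theorem Treated.record_succ {Acc : List Query → List ℕ → Prop} {k flag : ℕ} {q : ℕ → ℕ}
    {qs qs' : List Query} (h : Treated n m W p k Acc flag q qs) (hk : Candidate m W p k)
    (hAcc : ∀ cs, Acc qs cs → Acc qs' (cs ++ [k])) :
    ∃ cs : List ℕ, cs.Nodup ∧ (∀ i, i ∈ cs ↔ i < k + 1 ∧ Candidate m W p i) ∧ Acc qs' cs := by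
  obtain ⟨cs, h1, h2, h3⟩ := h.record
  refine ⟨cs ++ [k], ?_, fun i => ?_, hAcc cs h3⟩
  · refine List.nodup_append.2 ⟨h1, List.nodup_singleton k, fun a ha b hb => ?_⟩
    rw [List.mem_singleton.1 hb]
    exact ((h2 a).1 ha).1.ne
  · rw [List.mem_append, List.mem_singleton, h2 i, Nat.lt_succ_iff_lt_or_eq]
    constructor
    · rintro (h | rfl)
      · exact ⟨Or.inl h.1, h.2⟩
      · exact ⟨Or.inr rfl, hk⟩
    · rintro ⟨h | rfl, hc⟩
      · exact Or.inl ⟨h, hc⟩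
      · exact Or.inr rfl

theorem exec_improve {α : ℝ} {find : LoopProg} {Acc : List Query → List ℕ → Prop}
    (hα : ∀ l o, u l o = α ↔ ∀ l' o', u l' o' ≤ u l o) (hp : ∀ o < m, p o < n)
    (hfind : Finds F u (TopFor u α) p Acc find) (h0 : Acc [] []) {σ : State}
    (hn : σ.vars 0 = n) (hm : σ.vars 1 = m) (hσ : ∀ o < m, σ.arrs 0 0 o = p o) :
    ∃ q, Treated n m (TopFor u α) p n Acc (((improve find).exec F u σ).vars 2) q
        ((improve find).queries F u σ) ∧
      ∀ o < m, ((improve find).exec F u σ).arrs 0 0 o =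
        if ((improve find).exec F u σ).vars 2 = 0 then p o else q o := by
  set W := TopFor u α with hW
  have hr₁ : Ready n m W p (findTopPart.exec F u (topTable.exec F u σ)) :=
    exec_findTopPart hp ((exec_vars rfl σ).trans hn) ((exec_vars rfl σ).trans hm)
      (by rw [exec_arrs rfl σ]; exact hσ) (exec_topTable hα hn hm)
  set σ₁ := (assign 2 (.const 0)).exec F u (findTopPart.exec F u (topTable.exec F u σ)) with hσ₁
  replace hr₁ : Ready n m W p σ₁ := hr₁.exec rfl rfl rfl rfl rfl
  have hflag : σ₁.vars 2 = 0 := rfl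
  have hv := hfind.vars
  have ha := hfind.arrs
  set body := testCandidate ;;
    cond (.lt (.const 0) (.var 8))
      (find ;;
        cond (.lt (.const 0) (.var 9))
          (distribute ;; copyRow 5 (.const 0) 9 (.const 0) ;; assign 2 (.const 1))) with hbody
  have hbv : ∀ y, y ≤ 1 ∨ y = 3 → body.writesVar y = false := by
    intro y hy
    rw [hbody]
    simp only [writesVar, hv y (by omega)]
    rcases hy with h | rfl
    · interval_cases y <;> rfl
    · rfl
  have hba : ∀ a ≤ 2, body.writesArr a = false := by
    intro a h
    rw [hbody]
    simp only [writesArr, ha a (Or.inl h)]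
    interval_cases a <;> rfl
  have hloop := loop_induction_queries (F := F) (u := u) (x := 3) (r := .agents) (P := body)
    (σ := σ₁) (fun k τ qs => Treated n m W p k Acc (τ.vars 2) (τ.arrs 5 0) qs)
    ⟨Or.inl ⟨hflag, fun i hi => absurd hi (Nat.not_lt_zero i)⟩,
      [], List.nodup_nil, by simp, h0⟩ ?_
  · have hn₁ : LoopRange.size σ₁ .agents = n := hr₁.agents
    rw [hn₁] at hloop
    set σ₂ := (loop 3 .agents body).exec F u σ₁ with hσ₂
    have hlv : ∀ y ≤ 1, (loop 3 .agents body).writesVar y = false := by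
      intro y hy
      simp only [writesVar, hbv y (Or.inl hy)]
      interval_cases y <;> rfl
    have hm₂ : σ₂.vars 1 = m := (exec_vars (hlv 1 le_rfl) σ₁).trans hr₁.objects
    have ha₂ : σ₂.arrs 0 = σ₁.arrs 0 :=
      exec_arrs (show (loop 3 .agents body).writesArr 0 = false from hba 0 (by decide)) σ₁
    have hexec : (improve find).exec F u σ =
        (cond (.lt (.const 0) (.var 2)) (copyRow 0 (.const 0) 5 (.const 0))).exec F u σ₂ := rfl
    have hq : (improve find).queries F u σ = (loop 3 .agents body).queries F u σ₁ := by
      simp only [improve, ← hbody, queries_seq, ← hσ₁]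
      rw [queries_eq_nil (P := topTable) rfl, queries_eq_nil (P := findTopPart) rfl,
        queries_eq_nil (P := assign 2 (.const 0)) rfl,
        queries_eq_nil (P := cond _ (copyRow 0 (.const 0) 5 (.const 0))) rfl]
      simp [hσ₁]
    have hflag₂ : ((improve find).exec F u σ).vars 2 = σ₂.vars 2 := by
      rw [hexec]; exact exec_vars rfl σ₂
    refine ⟨σ₂.arrs 5 0, by rwa [hflag₂, hq], fun o ho => ?_⟩
    rw [hflag₂, hexec]
    by_cases h2 : σ₂.vars 2 = 0
    · rw [exec_cond_neg (by simp [Test.Holds, Expr.eval, h2]), if_pos h2, ha₂]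
      exact hr₁.owner o ho
    · rw [exec_cond_pos (by simp only [Test.Holds, Expr.eval]; omega), if_neg h2]
      exact (exec_copyRow (a := 0) (b := 5) (i := .const 0) (j := .const 0) (I := 0) (J := 0)
        hm₂ (fun _ _ _ => ⟨rfl, rfl⟩) (by simp)).1 o ho
  · intro k hk τ qs hvτ haτ hxk hI
    have hkn : k < n := lt_of_lt_of_eq hk hr₁.agents
    have hv' : ∀ y ≤ 1, τ.vars y = σ₁.vars y := fun y hy => hvτ y (by
      simp only [writesVar, hbv y (Or.inl hy)]
      interval_cases y <;> rfl)
    have hτ : Ready n m W p τ := hr₁.congr (hv' 0 (by decide)) (hv' 1 le_rfl)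
      (haτ 0 (hba 0 (by decide))) (haτ 1 (hba 1 (by decide))) (haτ 2 (hba 2 le_rfl))
    have hcand := exec_testCandidate (F := F) (u := u) hp hτ
    rw [hxk] at hcand
    set τ₁ := testCandidate.exec F u τ with hτ₁
    have hr : Ready n m W p τ₁ := hτ.exec rfl rfl rfl rfl rfl
    have h2τ : τ₁.vars 2 = τ.vars 2 := exec_vars rfl τ
    have h3τ : τ₁.vars 3 = k := (exec_vars rfl τ).trans hxk
    have h5τ : τ₁.arrs 5 = τ.arrs 5 := exec_arrs rfl τ
    rw [hbody, exec_seq, queries_seq, queries_eq_nil (P := testCandidate) rfl, ← hτ₁,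
      List.nil_append]
    by_cases hc : Candidate m W p k
    swap
    · have htest : ¬ Test.Holds u τ₁ (.lt (.const 0) (.var 8)) := by rwa [← hcand] at hc
      rw [exec_cond_neg htest, queries_cond_neg htest, List.append_nil]
      simpa [State.setVar, h2τ, h5τ] using hI.skip hc
    have htest : Test.Holds u τ₁ (.lt (.const 0) (.var 8)) := hcand.2 hc
    rw [exec_cond_pos htest, queries_cond_pos htest, exec_seq, queries_seq,
      queries_eq_nil (P := cond _ (distribute ;; copyRow 5 (.const 0) 9 (.const 0) ;;
        assign 2 (.const 1))) rfl, List.append_nil]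
    have hrec := hI.record_succ hc (fun cs => hfind.acc τ₁ k hr hkn h3τ qs cs)
    have hdec := hfind.decides τ₁ k hr hkn h3τ
    set τ₂ := find.exec F u τ₁ with hτ₂
    have hr₂ : Ready n m W p τ₂ := hr.exec (hv 0 (by decide)) (hv 1 (by decide))
      (ha 0 (by decide)) (ha 1 (by decide)) (ha 2 (by decide))
    by_cases hfound : Test.Holds u τ₂ (.lt (.const 0) (.var 9))
    · have hM := hdec.1 hfound
      rw [exec_cond_pos hfound, exec_seq, exec_seq]
      have hdist := exec_distribute (F := F) (u := u) hp hr₂.agents hr₂.objects hr₂.owner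
        (fun x hx => hM.tally_le hc hx)
      set τ₃ := distribute.exec F u τ₂ with hτ₃
      have hcopy := (exec_copyRow (F := F) (u := u) (a := 5) (b := 9) (i := .const 0)
        (j := .const 0) (I := 0) (J := 0)
        (show τ₃.vars 1 = m from (exec_vars rfl τ₂).trans hr₂.objects)
        (fun _ _ _ => ⟨rfl, rfl⟩) (by simp)).1
      obtain ⟨hd1, hd2, hd3⟩ := hdist
      refine ⟨Or.inr ⟨rfl, k, hkn, τ₂.arrs 9 0, hM, fun o ho => ?_, fun o ho hMo => ?_,
        fun x hx => ?_⟩, hrec⟩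
      · exact (hcopy o ho).trans_lt (hd1 o ho)
      · exact (hcopy o ho).trans (hd2 o ho hMo)
      · exact (tally_congr hcopy x).trans (hd3 x hx)
    · rw [exec_cond_neg hfound]
      have h2τ₂ : τ₂.vars 2 = τ.vars 2 := (exec_vars (hv 2 (by decide)) τ₁).trans h2τ
      have h5τ₂ : τ₂.arrs 5 = τ.arrs 5 := (exec_arrs (ha 5 (by decide)) τ₁).trans h5τ
      have ho := hI.answer
      refine ⟨?_, hrec⟩
      simp only [State.setVar, ne_eq, Nat.reduceEqDiff, not_false_eq_true, Function.update_of_ne,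
        h2τ₂, h5τ₂]
      refine ho.imp_left fun ⟨h1, h2⟩ => ⟨h1, fun i hi hci => ?_⟩
      rcases Nat.lt_succ_iff_lt_or_eq.1 hi with hi | rfl
      · exact h2 i hi hci
      · exact hdec.2 hfound

/-- The bundles keep their sizes and contain the top objects given by `M`. Completion may add
further top objects by chance, so the counts are only bounded below. -/
theorem Augments.dominates {α β : ℝ} (h : BivaluedWith u α β) {p : Assignment n m} {i : ℕ}
    (hi : i < n) {M q : ℕ → ℕ} (hM : Augments n m (TopFor u α) (ownerRow p) i M)
    (hq : Completes n m (ownerRow p) M q) :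
    ∃ q' : Assignment n m, (∀ o : Fin m, q o = q' o) ∧ Dominates u q' p := by
  obtain ⟨hq1, hq2, hq3⟩ := hq
  let q' : Assignment n m := fun o => ⟨q o, hq1 o o.2⟩
  have hrow : ∀ o < m, ownerRow q' o = q o := fun o ho => ownerRow_val q' ⟨o, ho⟩
  have htop : ∀ l : Fin n, (bundleAt u α p l).card + (if (l : ℕ) = i then 1 else 0) ≤
      (bundleAt u α q' l).card := by
    intro l
    rw [card_bundleAt, card_bundleAt, ← hM.2 l l.2]
    refine Finset.sum_le_sum fun o ho => ?_
    have ho := Finset.mem_range.1 ho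
    split_ifs with h1 h2
    · exact le_rfl
    · refine absurd ((topPart_eq_iff l.2).2 ⟨?_, ?_⟩) h2
      · rw [hrow o ho, hq2 o ho (h1 ▸ l.2), h1]
      · rw [← h1]; exact hM.1 o ho (h1 ▸ l.2)
    · exact zero_le_one
    · exact le_rfl
  refine ⟨q', fun o => rfl, dominates_of_card h (fun l => ?_)
    (fun l => (Nat.le_add_right _ _).trans (htop l)) ⟨⟨i, hi⟩, ?_⟩⟩
  · rw [card_bundle, card_bundle, tally_congr hrow, hq3 l l.2]
  · simpa using htop ⟨i, hi⟩

/-- The improvement program answers correctly. -/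
theorem improve_correct {α β : ℝ} {find : LoopProg} {Acc : List Query → List ℕ → Prop}
    (h : BivaluedWith u α β) (hα : ∀ l o, u l o = α ↔ ∀ l' o', u l' o' ≤ u l o)
    {p : Assignment n m} (hfind : Finds F u (TopFor u α) (ownerRow p) Acc find) (h0 : Acc [] [])
    {σ : State} (hn : σ.vars 0 = n) (hm : σ.vars 1 = m) (hσ : σ.HoldsAssignment p) :
    let σ' := (improve find).exec F u σ
    (ParetoOptimal u p ∧ σ'.vars 2 = 0 ∧ σ'.HoldsAssignment p ∨
      ∃ q : Assignment n m, Dominates u q p ∧ σ'.vars 2 = 1 ∧ σ'.HoldsAssignment q) ∧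
    (ParetoOptimal u p ↔ ∀ i < n, Candidate m (TopFor u α) (ownerRow p) i →
      ∀ M, ¬ Augments n m (TopFor u α) (ownerRow p) i M) ∧
    ∃ cs : List ℕ, cs.Nodup ∧
      (∀ i, i ∈ cs ↔ i < n ∧ Candidate m (TopFor u α) (ownerRow p) i) ∧
      Acc ((improve find).queries F u σ) cs := by
  obtain ⟨q, hT, hrow⟩ := exec_improve hα (fun o ho => ownerRow_lt p ho) hfind h0 hn hm
    (fun o ho => by rw [hσ ⟨o, ho⟩, ← ownerRow_val p ⟨o, ho⟩])
  intro σ'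
  rcases hT.answer with ⟨hflag, hno⟩ | ⟨hflag, i, hi, M, hM, hq⟩
  · have hpo := paretoOptimal_of_not_augments h p hno
    refine ⟨Or.inl ⟨hpo, hflag, fun o => ?_⟩, iff_of_true hpo hno, hT.record⟩
    rw [hrow o o.2, if_pos hflag, ownerRow_val]
  · obtain ⟨q', hq', hd⟩ := hM.dominates h hi hq
    refine ⟨Or.inr ⟨q', hd, hflag, fun o => ?_⟩,
      ⟨fun hpo => absurd ⟨q', hd⟩ hpo, paretoOptimal_of_not_augments h p⟩, hT.record⟩
    rw [hrow o o.2, if_neg (by omega), hq']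

theorem inputState_holds (p : Assignment n m) : (inputState p).HoldsAssignment p := by
  intro o
  simp [inputState]

theorem search_finds (hp : ∀ o < m, p o < n) :
    Finds F u W p (fun _ _ => True) search where
  vars y hy := by interval_cases y <;> rfl
  arrs a ha := by
    rcases ha with ha | rfl
    · interval_cases a <;> rfl
    · rfl
  decides τ i hτ hi h3 := exec_search hp hτ hi h3
  acc _ _ _ _ _ _ _ _ := trivial

/-- The improvement program, with the answer copied to variable `0`. -/
def improveProg (find : LoopProg) : Prog :=
  -- Variable 0 holds `n`, the bound of the loops, until `improve` has halted.
  .seq (improve find).compile (.assign 0 (.var 2))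

theorem runs_improveProg {find : LoopProg} (hok : (improve find).CountersKept = true)
    (hf0 : (improve find).writesVar 0 = false) (hf1 : (improve find).writesVar 1 = false)
    {p : Assignment n m}
    (hans : let σ' := (improve find).exec F u (inputState p)
      ParetoOptimal u p ∧ σ'.vars 2 = 0 ∧ σ'.HoldsAssignment p ∨
        ∃ q : Assignment n m, Dominates u q p ∧ σ'.vars 2 = 1 ∧ σ'.HoldsAssignment q) :
    ∃ σ t, Runs F u (improveProg find) (inputState p) σ t
        ((improve find).queries F u (inputState p)) ∧
      t ≤ ((improve find).time + 2).eval (n + m) ∧ AnswersImprovement u p σ := by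
  obtain ⟨t, ht, hb⟩ := runs_exec (F := F) (u := u) hok hf0 hf1 (N := n + m) (inputState p)
    (by simp [inputState])
  refine ⟨_, _, by simpa [improveProg] using Runs.seq ht (Runs.assign _ 0 (.var 2)), ?_, ?_⟩
  · simp only [Polynomial.eval_add, Expr.cost, Polynomial.eval_ofNat]
    omega
  · refine hans.imp (fun h => ⟨h.1, ?_, h.2.2⟩) fun ⟨q, h⟩ => ⟨q, h.1, ?_, h.2.2⟩
    · simpa [State.setVar, Expr.eval] using h.2.1
    · simpa [State.setVar, Expr.eval] using h.2.1

/-! ### The polynomial-time programs without a solver. -/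

theorem polynomial_time_test :
    ∃ (P : Prog) (T : Polynomial ℕ), P.CallFree ∧
      ∀ (n m : ℕ) (u : Utility n m), Bivalued u → ∀ (p : Assignment n m) (F : Solver),
        ∃ (σ : State) (t : ℕ), Runs F u P (inputState p) σ t [] ∧
          t ≤ T.eval (n + m) ∧ AnswersImprovement u p σ := by
  refine ⟨improveProg search, (improve search).time + 2, ⟨callFree_compile rfl, trivial⟩,
    fun n m u hu p F => ?_⟩
  obtain ⟨α, β, h, hα⟩ := hu.exists_max
  have hans := (improve_correct (F := F) h hα (search_finds fun o ho => ownerRow_lt p ho)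
    trivial rfl rfl (inputState_holds p)).1
  obtain ⟨σ, t, hr, hb⟩ := runs_improveProg rfl rfl rfl hans
  rw [queries_eq_nil rfl] at hr
  exact ⟨σ, t, hr, hb⟩

/-- Run `improve` `m` times. On a Pareto optimal assignment it returns the assignment itself, so
superfluous rounds do no harm; nor does memory left over from earlier rounds, as `improve_correct`
presupposes only the two sizes and the current assignment. -/
theorem polynomial_time_optimum :
    ∃ (P : Prog) (T : Polynomial ℕ), P.CallFree ∧
      ∀ (n m : ℕ) (u : Utility n m), Bivalued u → ∀ (e : Assignment n m) (F : Solver),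
        ∃ (σ : State) (t : ℕ), Runs F u P (inputState e) σ t [] ∧
          t ≤ T.eval (n + m) ∧ ∃ q : Assignment n m, σ.HoldsAssignment q ∧
            IndividuallyRational u e q ∧ ParetoOptimal u q := by
  refine ⟨(loop 12 .objects (improve search)).compile,
    (loop 12 .objects (improve search)).time, callFree_compile rfl,
    fun n m u hu e F => ?_⟩
  obtain ⟨α, β, h, hα⟩ := hu.exists_max
  obtain ⟨t, ht, hb⟩ := runs_exec (F := F) (u := u) (P := loop 12 .objects (improve search))
    rfl rfl rfl (N := n + m) (inputState e) (by simp [inputState])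
  rw [queries_eq_nil rfl] at ht
  refine ⟨_, t, ht, hb, ?_⟩
  have hloop := loop_induction (F := F) (u := u) (x := 12) (r := .objects) (P := improve search)
    (σ := inputState e) (fun k τ => ∃ q : Assignment n m, τ.HoldsAssignment q ∧
      IndividuallyRational u e q ∧ (ParetoOptimal u q ∨ k ≤ ∑ i, (bundleAt u α q i).card))
    ⟨e, inputState_holds e, fun _ => le_rfl, Or.inr (Nat.zero_le _)⟩ ?_
  · obtain ⟨q, h1, h2, h3⟩ := hloop
    exact ⟨q, h1, h2, paretoOptimal_of_progress h h3⟩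
  · rintro k hk τ hv ha hx ⟨q, hq, hir, hprog⟩
    have hans := (improve_correct (F := F) h hα (search_finds fun o ho => ownerRow_lt q ho)
      trivial ((hv 0 rfl).trans rfl) ((hv 1 rfl).trans rfl) hq).1
    rcases hans with ⟨hpo, -, hq'⟩ | ⟨q', hd, -, hq'⟩
    · exact ⟨q, hq', hir, Or.inl hpo⟩
    · exact ⟨q', hq', hir.trans hd.1, progress_step h hprog (Or.inr hd)⟩

end Improve

/-! ## Flows and matchings -/

section Flow

variable {n m : ℕ}

theorem FlowNetwork.IsFlow.eq_zero {V : Type} [Fintype V] {G : FlowNetwork V} {f : V → V → ℕ}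
    (hf : G.IsFlow f) {v w : V} (h : G.cap v w = 0) : f v w = 0 :=
  Nat.le_zero.1 (h ▸ hf.1 v w)

/-- Maximum flows do not depend on the numbering of the vertices. -/
theorem FlowNetwork.IsMaxFlow.comap {V V' : Type} [Fintype V] [Fintype V'] {G : FlowNetwork V}
    {G' : FlowNetwork V'} (e : V ≃ V') (hcap : ∀ v w, G'.cap (e v) (e w) = G.cap v w)
    (hs : G'.source = e G.source) (ht : G'.sink = e G.sink) {f : V' → V' → ℕ}
    (hf : G'.IsMaxFlow f) : G.IsMaxFlow fun v w => f (e v) (e w) := by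
  have hval : ∀ g : V' → V' → ℕ, G.value (fun v w => g (e v) (e w)) = G'.value g := by
    intro g
    simp only [FlowNetwork.value, hs]
    rw [e.sum_comp fun w => (g (e G.source) w : ℤ), e.sum_comp fun w => (g w (e G.source) : ℤ)]
  refine ⟨⟨fun v w => hcap v w ▸ hf.1.1 _ _, fun v hv hv' => ?_⟩, fun g hg => ?_⟩
  · rw [e.sum_comp fun w => f (e v) w, e.sum_comp fun w => f w (e v)]
    exact hf.1.2 _ (by rw [hs]; exact fun h => hv (e.injective h))
      (by rw [ht]; exact fun h => hv' (e.injective h))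
  · have hg' := hf.2 (fun v w => g (e.symm v) (e.symm w)) ⟨fun v w => ?_, fun v hv hv' => ?_⟩
    · rw [← hval] at hg'
      rw [hval]
      simpa [hval] using hg'
    · simpa [← hcap] using hg.1 (e.symm v) (e.symm w)
    · rw [e.symm.sum_comp fun w => g (e.symm v) w, e.symm.sum_comp fun w => g w (e.symm v)]
      refine hg.2 _ ?_ ?_
      · rintro h; exact hv (by rw [hs, ← h, Equiv.apply_symm_apply])
      · rintro h; exact hv' (by rw [ht, ← h, Equiv.apply_symm_apply])

def vertexSumEquiv (n m : ℕ) : Vertex n m ≃ (Fin n ⊕ Fin m) ⊕ (Unit ⊕ Unit) where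
  toFun
    | .agent l => .inl (.inl l)
    | .object o => .inl (.inr o)
    | .source => .inr (.inl ())
    | .sink => .inr (.inr ())
  invFun
    | .inl (.inl l) => .agent l
    | .inl (.inr o) => .object o
    | .inr (.inl _) => .source
    | .inr (.inr _) => .sink
  left_inv v := by cases v <;> rfl
  right_inv v := by rcases v with (v | v) | (v | v) <;> rfl

theorem sum_vertex {A : Type*} [AddCommMonoid A] (f : Vertex n m → A) :
    ∑ v, f v = ∑ l, f (.agent l) + ∑ o, f (.object o) + (f .source + f .sink) := by
  rw [← (vertexSumEquiv n m).symm.sum_comp f]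
  simp [vertexSumEquiv]

variable {u : Utility n m} {α : ℝ} {p : Assignment n m} {i : Fin n}
  {f : Vertex n m → Vertex n m → ℕ}

theorem source_le (hf : (improvementNetwork u α p i).IsFlow f) (l : Fin n) :
    f .source (.agent l) ≤ (bundleAt u α p l).card + if l = i then 1 else 0 :=
  hf.1 .source (.agent l)

/-- Conservation at `l`: all other edges at this vertex have capacity zero. -/
theorem sum_agent (hf : (improvementNetwork u α p i).IsFlow f) (l : Fin n) :
    ∑ o, f (.agent l) (.object o) = f .source (.agent l) := by
  have h := hf.2 (.agent l) (by simp [improvementNetwork]) (by simp [improvementNetwork])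
  rw [sum_vertex, sum_vertex] at h
  have hz : ∀ v w, improvementCap u α p i v w = 0 → f v w = 0 := fun v w => hf.eq_zero
  simpa [hz (.agent l) (.agent _) rfl, hz (.agent l) .source rfl, hz (.agent l) .sink rfl,
    hz (.agent _) (.agent l) rfl, hz (.object _) (.agent l) rfl, hz .sink (.agent l) rfl] using h

theorem sum_object_le (hf : (improvementNetwork u α p i).IsFlow f) (o : Fin m) :
    ∑ l, f (.agent l) (.object o) ≤ 1 := by
  have h := hf.2 (.object o) (by simp [improvementNetwork]) (by simp [improvementNetwork])
  rw [sum_vertex, sum_vertex] at h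
  have hz : ∀ v w, improvementCap u α p i v w = 0 → f v w = 0 := fun v w => hf.eq_zero
  have h' : f (.object o) .sink = ∑ l, f (.agent l) (.object o) := by
    simpa [hz (.object o) (.agent _) rfl, hz (.object o) (.object _) rfl,
      hz (.object o) .source rfl, hz (.object _) (.object o) rfl, hz .source (.object o) rfl,
      hz .sink (.object o) rfl] using h
  rw [← h']
  exact hf.1 (.object o) .sink

theorem value_eq (hf : (improvementNetwork u α p i).IsFlow f) :
    (improvementNetwork u α p i).value f = ∑ l, (f .source (.agent l) : ℤ) := by
  have hz : ∀ v w, improvementCap u α p i v w = 0 → f v w = 0 := fun v w => hf.eq_zero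
  rw [FlowNetwork.value, sum_vertex, sum_vertex]
  simp [improvementNetwork, hz (.agent _) .source rfl, hz (.object _) .source rfl,
    hz .sink .source rfl, hz .source .sink rfl, hz .source (.object _) rfl]

theorem targetValue_eq : targetValue u α p =
    ∑ l, (((bundleAt u α p l).card + if l = i then 1 else 0 : ℕ) : ℤ) := by
  simp [targetValue, Finset.sum_add_distrib]

theorem value_le (hf : (improvementNetwork u α p i).IsFlow f) :
    (improvementNetwork u α p i).value f ≤ targetValue u α p := by
  rw [value_eq hf, targetValue_eq (i := i)]
  exact Finset.sum_le_sum fun l _ => by exact_mod_cast source_le hf l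

/-- A flow of the target value saturates all edges at the source. -/
theorem value_eq_target_iff (hf : (improvementNetwork u α p i).IsFlow f) :
    (improvementNetwork u α p i).value f = targetValue u α p ↔
      ∀ l, f .source (.agent l) = (bundleAt u α p l).card + if l = i then 1 else 0 := by
  rw [value_eq hf, targetValue_eq (i := i),
    Finset.sum_eq_sum_iff_of_le fun l _ => by exact_mod_cast source_le hf l]
  simp only [Finset.mem_univ, true_implies, Nat.cast_inj]

/-- The matching that is read from a saturating flow. -/
theorem augments_of_flow (hf : (improvementNetwork u α p i).IsFlow f)
    (hsat : ∀ l, f .source (.agent l) = (bundleAt u α p l).card + if l = i then 1 else 0)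
    {M : ℕ → ℕ} (h1 : ∀ (o : Fin m) (l : Fin n), M o = l → 0 < f (.agent l) (.object o))
    (h2 : ∀ (o : Fin m) (l : Fin n), 0 < f (.agent l) (.object o) → M o < n) :
    Augments n m (TopFor u α) (ownerRow p) i M := by
  refine ⟨fun o ho hn => ?_, fun x hx => ?_⟩
  · have hpos := h1 ⟨o, ho⟩ ⟨M o, hn⟩ rfl
    refine (topFor_val ⟨M o, hn⟩ ⟨o, ho⟩).2 ?_
    by_contra hne
    have hle : f (.agent ⟨M o, hn⟩) (.object ⟨o, ho⟩) ≤
        if u ⟨M o, hn⟩ ⟨o, ho⟩ = α then 1 else 0 := hf.1 _ _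
    rw [if_neg hne] at hle
    omega
  · have hcard := card_bundleAt (u := u) (α := α) p ⟨x, hx⟩
    have hsum := sum_agent hf ⟨x, hx⟩
    rw [hsat, hcard] at hsum
    simp only [Fin.ext_iff] at hsum
    rw [← hsum, tally, ← Fin.sum_univ_eq_sum_range (fun o => if M o = x then 1 else 0)]
    refine Finset.sum_congr rfl fun o _ => ?_
    have hle := sum_object_le hf o
    have hle' : ∀ l, f (.agent l) (.object o) ≤ 1 := fun l =>
      (Finset.single_le_sum (f := fun l => f (.agent l) (.object o))
        (fun _ _ => Nat.zero_le _) (Finset.mem_univ l)).trans hle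
    split_ifs with h
    · have := h1 o ⟨x, hx⟩ h
      have := hle' ⟨x, hx⟩
      omega
    · by_contra hne
      have hpos : 0 < f (.agent ⟨x, hx⟩) (.object o) := by omega
      have hlt := h2 o _ hpos
      have hpos' := h1 o ⟨M o, hlt⟩ rfl
      -- Two different agents would send flow through an object that can pass on only one unit.
      have hpair := Finset.sum_le_sum_of_subset (f := fun l => f (.agent l) (.object o))
        (Finset.subset_univ {(⟨x, hx⟩ : Fin n), ⟨M o, hlt⟩})
      rw [Finset.sum_pair (by rw [ne_eq, Fin.mk.injEq]; exact fun h' => h h'.symm)] at hpair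
      omega

theorem exists_augments_of_value (hf : (improvementNetwork u α p i).IsFlow f)
    (hval : (improvementNetwork u α p i).value f = targetValue u α p) :
    ∃ M, Augments n m (TopFor u α) (ownerRow p) i M := by
  classical
  have hM : ∀ o : Fin m, ∃ k : ℕ, (∀ l : Fin n, k = l → 0 < f (.agent l) (.object o)) ∧
      ∀ l : Fin n, 0 < f (.agent l) (.object o) → k < n := by
    intro o
    by_cases h : ∃ l, 0 < f (.agent l) (.object o)
    · obtain ⟨l, hl⟩ := h
      exact ⟨l, fun l' h' => Fin.ext h' ▸ hl, fun _ _ => l.2⟩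
    · exact ⟨n, fun l h' => absurd l.2 (by omega), fun l hl => absurd ⟨l, hl⟩ h⟩
  choose k hk using hM
  refine ⟨fun o => if h : o < m then k ⟨o, h⟩ else n,
    augments_of_flow hf ((value_eq_target_iff hf).1 hval) (fun o l h => ?_) fun o l h => ?_⟩
  · exact (hk o).1 l (by simpa using h)
  · simpa using (hk o).2 l h

/-- The flow that a matching describes. -/
noncomputable def matchingFlow (u : Utility n m) (α : ℝ) (p : Assignment n m) (i : Fin n)
    (M : ℕ → ℕ) : Vertex n m → Vertex n m → ℕ
  | .agent l, .object o => if M o = l then 1 else 0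
  | .object o, .sink => if M o < n then 1 else 0
  | .source, .agent l => (bundleAt u α p l).card + if l = i then 1 else 0
  | _, _ => 0

/-- For `matchingFlow`, conservation at an agent is the tally condition of `Augments`, and
conservation at an object says that it has at most one owner. -/
theorem exists_flow_of_augments {M : ℕ → ℕ}
    (hM : Augments n m (TopFor u α) (ownerRow p) i M) :
    ∃ f, (improvementNetwork u α p i).IsFlow f ∧
      (improvementNetwork u α p i).value f = targetValue u α p := by
  have hflow : (improvementNetwork u α p i).IsFlow (matchingFlow u α p i M) := by
    refine ⟨fun v w => ?_, fun v hv hv' => ?_⟩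
    · rcases v with l | o | _ | _ <;> rcases w with l' | o' | _ | _ <;>
        simp only [improvementNetwork, improvementCap, matchingFlow, le_refl]
      · by_cases h : M o' = l
        · have := hM.1 o' o'.2 (h ▸ l.2)
          rw [h, topFor_val] at this
          simp only [h, this, if_true, le_refl]
        · simp [h]
      · split_ifs <;> simp
    · rw [sum_vertex, sum_vertex]
      rcases v with l | o | _ | _
      · simp only [matchingFlow, Finset.sum_const_zero, add_zero, zero_add]
        rw [card_bundleAt]
        have := hM.2 l l.2
        rw [tally, ← Fin.sum_univ_eq_sum_range (fun o => if M o = l then 1 else 0)] at this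
        simpa only [Fin.ext_iff] using this
      · simp only [matchingFlow, Finset.sum_const_zero, add_zero, zero_add]
        by_cases h : M o < n
        · rw [if_pos h, Finset.sum_eq_single ⟨M o, h⟩] <;> simp +contextual [Fin.ext_iff, eq_comm]
        · rw [if_neg h, Finset.sum_eq_zero]
          intro l _
          rw [if_neg]
          have := l.2
          omega
      · exact absurd rfl hv
      · exact absurd rfl hv'
  exact ⟨_, hflow, (value_eq_target_iff hflow).2 fun l => rfl⟩

/-- The improvement network has a maximum flow of the target value if and only if the candidate
agent can get one more top object. -/
theorem maxFlow_value_iff : (∃ f, (improvementNetwork u α p i).IsMaxFlow f ∧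
    (improvementNetwork u α p i).value f = targetValue u α p) ↔
      ∃ M, Augments n m (TopFor u α) (ownerRow p) i M := by
  constructor
  · rintro ⟨f, hf, hval⟩
    exact exists_augments_of_value hf.1 hval
  · rintro ⟨M, hM⟩
    obtain ⟨f, hf, hval⟩ := exists_flow_of_augments hM
    exact ⟨f, ⟨hf, fun g hg => hval ▸ value_le hg⟩, hval⟩

/-- Needed because the solver may return any maximum flow: if some flow attains the upper bound
`targetValue`, this one does too. -/
theorem maxFlow_saturates {M : ℕ → ℕ} (hM : Augments n m (TopFor u α) (ownerRow p) i M)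
    (hf : (improvementNetwork u α p i).IsMaxFlow f) (l : Fin n) :
    f .source (.agent l) = (bundleAt u α p l).card + if l = i then 1 else 0 := by
  obtain ⟨g, hg, hval⟩ := exists_flow_of_augments hM
  exact (value_eq_target_iff hf.1).1 (le_antisymm (value_le hf.1) (hval ▸ hf.2 g hg)) l

/-- The numbering of the vertices: agents, objects, source, sink. -/
def vertexNumbering (n m : ℕ) : Vertex n m ≃ Fin (n + m + 2) where
  toFun
    | .agent l => ⟨l, by omega⟩
    | .object o => ⟨n + o, by omega⟩
    | .source => ⟨n + m, by omega⟩
    | .sink => ⟨n + m + 1, by omega⟩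
  invFun k :=
    if h : k < n then .agent ⟨k, h⟩
    else if h' : k < n + m then .object ⟨k - n, by omega⟩
    else if (k : ℕ) = n + m then .source else .sink
  left_inv v := by rcases v with l | o | _ | _ <;> simp [add_assoc]
  right_inv k := by
    ext
    dsimp only
    split_ifs <;> dsimp only <;> omega

end Flow

/-! ## The search by a maximum flow -/

/-- Computes in variable `6` the capacity of the edge from vertex `4` to vertex `5`. -/
def computeCap : LoopProg :=
  assign 6 (.const 0) ;;
  cond (.and (.and (.lt (.var 4) (.var 0)) (.not (.lt (.var 5) (.var 0))))
      (.and (.lt (.var 5) (.add (.var 0) (.var 1)))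
        (.lt (.const 0) (.get 1 (.var 4) (.sub (.var 5) (.var 0))))))
    (assign 6 (.const 1)) ;;
  cond (.and (.not (.lt (.var 4) (.var 0))) (.and (.lt (.var 4) (.add (.var 0) (.var 1)))
      (.lt (.add (.var 0) (.var 1)) (.var 5))))
    (assign 6 (.const 1)) ;;
  cond (.and (.not (.lt (.var 4) (.add (.var 0) (.var 1))))
      (.and (.not (.lt (.add (.var 0) (.var 1)) (.var 4))) (.lt (.var 5) (.var 0))))
    (assign 6 (.get 6 (.const 0) (.var 5))) ;;
  -- For the source edge of the candidate this overrides the value just assigned.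
  cond (.and (.and (.not (.lt (.var 4) (.add (.var 0) (.var 1))))
        (.not (.lt (.add (.var 0) (.var 1)) (.var 4))))
      (.and (.not (.lt (.var 5) (.var 3))) (.not (.lt (.var 3) (.var 5)))))
    (assign 6 (.add (.get 6 (.const 0) (.var 5)) (.const 1)))

/-- Builds the network of the candidate agent in variable `3` in array `7`. -/
def buildNetwork : LoopProg :=
  tallyRow 2 ;;
  loop 4 .vertices (loop 5 .vertices (computeCap ;; store 7 (.var 4) (.var 5) (.var 6)))

/-- Reads from the flow in array `8` whether all edges at the source are saturated, and which agent
gets which object. -/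
def readFlow : LoopProg :=
  assign 9 (.const 1) ;;
  loop 4 .agents
    (cond (.lt (.get 8 (.add (.var 0) (.var 1)) (.var 4)) (.get 7 (.add (.var 0) (.var 1)) (.var 4)))
      (assign 9 (.const 0))) ;;
  loop 5 .objects
    (store 9 (.const 0) (.var 5) (.var 0) ;;
      loop 4 .agents
        (cond (.lt (.const 0) (.get 8 (.var 4) (.add (.var 0) (.var 5))))
          (store 9 (.const 0) (.var 5) (.var 4))))

/-- Tries to give one more top object to the agent in variable `3`, by means of the solver. -/
def solveNetwork : LoopProg :=
  buildNetwork ;; maxflow 7 8 ;; readFlow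

section Network

variable {F : Solver} {n m : ℕ} {u : Utility n m} {α : ℝ} {p : Assignment n m} {i : Fin n}

open Classical in
-- Moves the case distinction from the state into the assigned value, so that `simp` can evaluate a
-- chain of conditional assignments.
theorem exec_cond_assign (b : Test) (x : ℕ) (e : Expr) (σ : State) :
    (cond b (assign x e)).exec F u σ =
      σ.setVar x (if b.Holds u σ then e.eval σ else σ.vars x) := by
  split_ifs with h
  · exact exec_cond_pos h _
  · rw [exec_cond_neg h, State.setVar, Function.update_eq_self]

theorem vars_setVar (σ : State) (x v y : ℕ) :
    (σ.setVar x v).vars y = if y = x then v else σ.vars y :=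
  Function.update_apply _ _ _ _

theorem arrs_setVar (σ : State) (x v : ℕ) : (σ.setVar x v).arrs = σ.arrs := rfl

theorem exec_computeCap {σ : State} (hσ : Ready n m (TopFor u α) (ownerRow p) σ)
    (h3 : σ.vars 3 = i) (h6 : ∀ l : Fin n, σ.arrs 6 0 l = (bundleAt u α p l).card)
    {v w : Vertex n m} (h4 : σ.vars 4 = vertexNumbering n m v)
    (h5 : σ.vars 5 = vertexNumbering n m w) :
    (computeCap.exec F u σ).vars 6 = improvementCap u α p i v w := by
  have htop := fun (l : Fin n) (o : Fin m) =>
    (hσ.top l l.2 o o.2).trans (topFor_val (u := u) (α := α) l o)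
  simp only [computeCap, exec_seq, exec_cond_assign, exec_assign, Test.Holds, Expr.eval,
    vars_setVar, arrs_setVar, Nat.reduceEqDiff, if_true, if_false, hσ.agents, hσ.objects, h3, h4,
    h5]
  rcases v with l | o | _ | _ <;> rcases w with l' | o' | _ | _ <;>
    simp [vertexNumbering, improvementCap]
  · rw [if_neg (by omega), if_neg (by omega)]
  · rw [if_neg (by omega)]
    simp only [htop]
  · omega
  · rw [if_neg (by omega), if_neg (by omega)]
  · omega
  · simp only [← le_antisymm_iff, h6, eq_comm (a := i)]
    split_ifs <;> rfl
  · omega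
  · omega
  · rw [if_neg (by omega), if_neg (by omega)]
  · omega

theorem exec_buildNetwork {σ : State} (hσ : Ready n m (TopFor u α) (ownerRow p) σ)
    (h3 : σ.vars 3 = i) (v w : Vertex n m) : (buildNetwork.exec F u σ).arrs 7
      (vertexNumbering n m v) (vertexNumbering n m w) = improvementCap u α p i v w := by
  have htally : ∀ l : Fin n, ((tallyRow 2).exec F u σ).arrs 6 0 l = (bundleAt u α p l).card := by
    intro l
    rw [exec_tallyRow (by decide) hσ.agents hσ.objects l.2, tally_congr hσ.part, card_bundleAt]
  have hr₁ : Ready n m (TopFor u α) (ownerRow p) ((tallyRow 2).exec F u σ) :=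
    hσ.exec rfl rfl rfl rfl rfl
  have h3₁ : ((tallyRow 2).exec F u σ).vars 3 = i := (exec_vars rfl σ).trans h3
  rw [buildNetwork, exec_seq]
  set σ₁ := (tallyRow 2).exec F u σ with hσ₁
  refine loop_loop_induction (F := F) (u := u) (x := 4) (y := 5) (r := .vertices)
    (s := .vertices) (σ := σ₁) (P := computeCap ;; store 7 (.var 4) (.var 5) (.var 6))
    (by decide) (by decide) (by decide) (by decide) (by decide) rfl rfl rfl
    (fun D τ => ∀ v w : Vertex n m, D (vertexNumbering n m v) (vertexNumbering n m w) →
      τ.arrs 7 (vertexNumbering n m v) (vertexNumbering n m w) = improvementCap u α p i v w)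
    (fun _ _ => False.elim) (fun D τ k h => h) (fun D τ k h => h) ?_ v w ?_
  · intro D a ha b hb τ hvτ haτ hx hy hI v w hD
    have hτ : Ready n m (TopFor u α) (ownerRow p) τ :=
      hr₁.congr (hvτ 0 rfl) (hvτ 1 rfl) (haτ 0 rfl) (haτ 1 rfl) (haτ 2 rfl)
    have h3τ : τ.vars 3 = i := (hvτ 3 rfl).trans h3₁
    have h6τ : τ.arrs 6 = σ₁.arrs 6 := haτ 6 rfl
    have h4 : (computeCap.exec F u τ).vars 4 = a := (exec_vars rfl τ).trans hx
    have h5 : (computeCap.exec F u τ).vars 5 = b := (exec_vars rfl τ).trans hy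
    have h7 : (computeCap.exec F u τ).arrs 7 = τ.arrs 7 := exec_arrs rfl τ
    simp only [exec_seq, exec_store, Expr.eval, State.setArr, true_and, h4, h5, h7]
    split_ifs with hab
    · exact exec_computeCap hτ h3τ (by rw [h6τ]; exact htally) (hx.trans hab.1.symm)
        (hy.trans hab.2.symm)
    · exact hI v w (hD.resolve_right hab)
  · have h := (vertexNumbering n m v).2
    have h' := (vertexNumbering n m w).2
    simp only [LoopRange.size, hr₁.agents, hr₁.objects]
    exact ⟨h, h'⟩

theorem exec_readFlow {σ : State} (hn : σ.vars 0 = n) (hm : σ.vars 1 = m) :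
    (0 < (readFlow.exec F u σ).vars 9 ↔ ∀ l < n, σ.arrs 7 (n + m) l ≤ σ.arrs 8 (n + m) l) ∧
      ∀ o < m, (∀ l < n, (readFlow.exec F u σ).arrs 9 0 o = l → 0 < σ.arrs 8 l (n + o)) ∧
        ∀ l < n, 0 < σ.arrs 8 l (n + o) → (readFlow.exec F u σ).arrs 9 0 o < n := by
  rw [readFlow, exec_seq, exec_seq]
  set σ₁ := (assign 9 (.const 1)).exec F u σ with hσ₁
  have hn₁ : σ₁.vars 0 = n := hn
  have hm₁ : σ₁.vars 1 = m := hm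
  have hsat := loop_induction (F := F) (u := u) (x := 4) (r := .agents)
    (P := cond (.lt (.get 8 (.add (.var 0) (.var 1)) (.var 4))
      (.get 7 (.add (.var 0) (.var 1)) (.var 4))) (assign 9 (.const 0))) (σ := σ₁)
    (fun k τ => 0 < τ.vars 9 ↔ ∀ l < k, σ.arrs 7 (n + m) l ≤ σ.arrs 8 (n + m) l)
    (by simp [hσ₁, exec_assign, vars_setVar, Expr.eval]) ?_
  swap
  · intro k hk τ hv ha hxk hI
    have h7 : τ.arrs 7 = σ.arrs 7 := ha 7 rfl
    have h8 : τ.arrs 8 = σ.arrs 8 := ha 8 rfl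
    have h0 : τ.vars 0 = n := (hv 0 rfl).trans hn₁
    have h1 : τ.vars 1 = m := (hv 1 rfl).trans hm₁
    simp only [exec_cond_assign, Test.Holds, Expr.eval, vars_setVar, h0, h1, h7, h8, hxk,
      Nat.reduceEqDiff, if_true, if_false]
    split_ifs with h
    · refine iff_of_false (lt_irrefl 0) fun h' => ?_
      exact absurd (h' k (Nat.lt_succ_self k)) (not_le.2 h)
    · rw [hI]
      refine ⟨fun h' l hl => ?_, fun h' l hl => h' l (by omega)⟩
      rcases Nat.lt_succ_iff_lt_or_eq.1 hl with hl | rfl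
      · exact h' l hl
      · exact not_lt.1 h
  set σ₂ := (loop 4 .agents (cond (.lt (.get 8 (.add (.var 0) (.var 1)) (.var 4))
    (.get 7 (.add (.var 0) (.var 1)) (.var 4))) (assign 9 (.const 0)))).exec F u σ₁ with hσ₂
  have hn₂ : σ₂.vars 0 = n := (exec_vars rfl σ₁).trans hn₁
  have hm₂ : σ₂.vars 1 = m := (exec_vars rfl σ₁).trans hm₁
  have h8₂ : σ₂.arrs 8 = σ.arrs 8 := exec_arrs rfl σ₁
  simp only [LoopRange.size, hn₁] at hsat
  have hread := loop_induction (F := F) (u := u) (x := 5) (r := .objects)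
    (P := store 9 (.const 0) (.var 5) (.var 0) ;;
      loop 4 .agents
        (cond (.lt (.const 0) (.get 8 (.var 4) (.add (.var 0) (.var 5))))
          (store 9 (.const 0) (.var 5) (.var 4)))) (σ := σ₂)
    (fun k τ => ∀ o < k, (∀ l < n, τ.arrs 9 0 o = l → 0 < σ.arrs 8 l (n + o)) ∧
        ∀ l < n, 0 < σ.arrs 8 l (n + o) → τ.arrs 9 0 o < n) (by simp) ?_
  · simp only [LoopRange.size, hm₂] at hread
    rw [exec_vars rfl σ₂]
    exact ⟨hsat, hread⟩
  · intro k hk τ hv ha hxk hI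
    have h0 : τ.vars 0 = n := (hv 0 rfl).trans hn₂
    have h8 : τ.arrs 8 = σ.arrs 8 := (ha 8 rfl).trans h8₂
    rw [exec_seq]
    set ρ := (store 9 (.const 0) (.var 5) (.var 0)).exec F u τ with hρ
    have hρ0 : ρ.vars 0 = n := h0
    have hρ5 : ρ.vars 5 = k := hxk
    have hρ8 : ρ.arrs 8 = σ.arrs 8 := (exec_arrs rfl τ).trans h8
    have hρ9 : ∀ o, ρ.arrs 9 0 o = if o = k then n else τ.arrs 9 0 o := fun o => by
      simp [hρ, exec_store, State.setArr, Expr.eval, h0, hxk]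
    have hin := loop_induction (F := F) (u := u) (x := 4) (r := .agents)
      (P := cond (.lt (.const 0) (.get 8 (.var 4) (.add (.var 0) (.var 5))))
          (store 9 (.const 0) (.var 5) (.var 4))) (σ := ρ)
      (fun j π => (∀ o < k, π.arrs 9 0 o = τ.arrs 9 0 o) ∧
        (∀ l < n, π.arrs 9 0 k = l → 0 < σ.arrs 8 l (n + k)) ∧
        ∀ l < j, 0 < σ.arrs 8 l (n + k) → π.arrs 9 0 k < n)
      ⟨fun o ho => (hρ9 o).trans (if_neg ho.ne), fun l hl h => ?_, by simp⟩ ?_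
    · simp only [LoopRange.size, hρ0] at hin
      intro o ho
      rcases Nat.lt_succ_iff_lt_or_eq.1 ho with ho | rfl
      · simp only [arrs_setVar, hin.1 o ho]
        exact hI o ho
      · exact hin.2
    · simp only [arrs_setVar, hρ9, if_true] at h
      omega
    · rintro j hj π hv' ha' hxj ⟨hJ1, hJ2, hJ3⟩
      have hjn : j < n := lt_of_lt_of_eq hj hρ0
      have h0' : π.vars 0 = n := (hv' 0 rfl).trans hρ0
      have h5' : π.vars 5 = k := (hv' 5 rfl).trans hρ5
      have h8' : π.arrs 8 = σ.arrs 8 := (ha' 8 rfl).trans hρ8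
      by_cases h : Test.Holds u π (.lt (.const 0) (.get 8 (.var 4) (.add (.var 0) (.var 5))))
      · rw [exec_cond_pos h]
        simp only [Test.Holds, Expr.eval, hxj, h0', h5', h8'] at h
        simp only [exec_store, State.setArr, arrs_setVar, Expr.eval, hxj, h5', true_and, if_true]
        refine ⟨fun o ho => by rw [if_neg ho.ne, hJ1 o ho], ?_, fun _ _ _ => hjn⟩
        rintro l hl rfl
        exact h
      · rw [exec_cond_neg h]
        simp only [Test.Holds, Expr.eval, hxj, h0', h5', h8'] at h
        refine ⟨hJ1, hJ2, fun l hl hpos => ?_⟩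
        rcases Nat.lt_succ_iff_lt_or_eq.1 hl with hl | rfl
        · exact hJ3 l hl hpos
        · exact absurd hpos h

/-- The network that is posed, and the state after the answer of the solver. -/
theorem exec_maxflow {σ : State} (hn : σ.vars 0 = n) (hm : σ.vars 1 = m)
    (hcap : ∀ v w : Vertex n m, σ.arrs 7 (vertexNumbering n m v) (vertexNumbering n m w) =
      improvementCap u α p i v w) (hF : F.Correct) :
    (∃ Q : Query, (maxflow 7 8).queries F u σ = [Q] ∧
      Q.IsNumberingOf (improvementNetwork u α p i)) ∧
    ∃ f, (improvementNetwork u α p i).IsMaxFlow f ∧ ∀ v w : Vertex n m,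
      ((maxflow 7 8).exec F u σ).arrs 8 (vertexNumbering n m v) (vertexNumbering n m w) =
        f v w := by
  -- The posed network has vertex type `Fin (σ.vars 0 + σ.vars 1 + 2)`, which now is the target of
  -- `vertexNumbering`.
  subst hn hm
  refine ⟨⟨_, rfl, vertexNumbering _ _, hcap, rfl, rfl⟩, _,
    (hF _ (network 7 σ)).comap (vertexNumbering _ _) hcap rfl rfl, fun v w => ?_⟩
  simp [exec, State.writeMatrix]

/-- If the flow saturates the source edges, the row read from it is an augmentation; if an
augmentation exists, the flow must saturate them. Each call appends one network to the record, that
of the candidate being treated. -/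
theorem solveNetwork_finds (hF : F.Correct) :
    Finds F u (TopFor u α) (ownerRow p)
      (List.Forall₂ fun Q i => ∃ h : i < n, Q.IsNumberingOf (improvementNetwork u α p ⟨i, h⟩))
      solveNetwork := by
  have key : ∀ τ i, Ready n m (TopFor u α) (ownerRow p) τ → (h : i < n) → τ.vars 3 = i →
      (∃ Q : Query, solveNetwork.queries F u τ = [Q] ∧
        Q.IsNumberingOf (improvementNetwork u α p ⟨i, h⟩)) ∧
      ((0 < (solveNetwork.exec F u τ).vars 9 →
        Augments n m (TopFor u α) (ownerRow p) i ((solveNetwork.exec F u τ).arrs 9 0)) ∧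
      (¬ 0 < (solveNetwork.exec F u τ).vars 9 →
        ∀ M, ¬ Augments n m (TopFor u α) (ownerRow p) i M)) := by
    intro τ i hτ hi h3
    have hcap := exec_buildNetwork (F := F) (i := ⟨i, hi⟩) hτ h3
    rw [solveNetwork, exec_seq, exec_seq, queries_seq, queries_seq,
      queries_eq_nil (P := buildNetwork) rfl, queries_eq_nil (P := readFlow) rfl,
      List.nil_append, List.append_nil]
    have hr₁ : Ready n m (TopFor u α) (ownerRow p) (buildNetwork.exec F u τ) :=
      hτ.exec rfl rfl rfl rfl rfl
    set τ₁ := buildNetwork.exec F u τ with hτ₁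
    obtain ⟨hQ, f, hf, hread⟩ := exec_maxflow hr₁.agents hr₁.objects hcap hF
    have hr₂ : Ready n m (TopFor u α) (ownerRow p) ((maxflow 7 8).exec F u τ₁) :=
      hr₁.exec rfl rfl rfl rfl rfl
    have h7 : ((maxflow 7 8).exec F u τ₁).arrs 7 = τ₁.arrs 7 := exec_arrs rfl τ₁
    set τ₂ := (maxflow 7 8).exec F u τ₁ with hτ₂
    obtain ⟨hflag, hrow⟩ := exec_readFlow (F := F) (u := u) hr₂.agents hr₂.objects
    have hsource : ∀ l : Fin n, τ₂.arrs 8 (n + m) l = f .source (.agent l) :=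
      fun l => hread .source (.agent l)
    have hcap' : ∀ l : Fin n, τ₂.arrs 7 (n + m) l =
        (bundleAt u α p l).card + if l = ⟨i, hi⟩ then 1 else 0 := fun l => by
      rw [h7]; exact hcap .source (.agent l)
    have hobj : ∀ (l : Fin n) (o : Fin m), τ₂.arrs 8 l (n + o) = f (.agent l) (.object o) :=
      fun l o => hread (.agent l) (.object o)
    refine ⟨hQ, fun hpos => ?_, fun hpos M hM => hpos (hflag.2 fun l hl => ?_)⟩
    · refine augments_of_flow hf.1 (fun l => le_antisymm (source_le hf.1 l) ?_)
        (fun o l h => ?_) fun o l h => ?_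
      · rw [← hsource, ← hcap']
        exact hflag.1 hpos l l.2
      · rw [← hobj]
        exact (hrow o o.2).1 l l.2 h
      · rw [← hobj] at h
        exact (hrow o o.2).2 l l.2 h
    · rw [hcap' ⟨l, hl⟩, hsource ⟨l, hl⟩]
      exact (maxFlow_saturates (i := ⟨i, hi⟩) hM hf ⟨l, hl⟩).ge
  refine ⟨fun y hy => ?_, fun a ha => ?_, fun τ i hτ hi h3 => (key τ i hτ hi h3).2,
    fun τ i hτ hi h3 qs cs h => ?_⟩
  · interval_cases y <;> rfl
  · rcases ha with ha | rfl
    · interval_cases a <;> rfl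
    · rfl
  · obtain ⟨⟨Q, hQ, hnum⟩, -⟩ := key τ i hτ hi h3
    rw [hQ]
    exact List.rel_append h (.cons ⟨hi, hnum⟩ .nil)

end Network

/-- Every candidate is treated exactly once, even after a success. So the record lists the networks
of all candidates without repetition, which gives the bound `n` on their number. -/
theorem polynomial_time_test_by_flows :
    ∃ (P : Prog) (T : Polynomial ℕ),
      ∀ (n m : ℕ) (u : Utility n m), Bivalued u → ∀ (p : Assignment n m) (F : Solver), F.Correct →
        ∃ (σ : State) (t : ℕ) (qs : List Query), Runs F u P (inputState p) σ t qs ∧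
          t ≤ T.eval (n + m) ∧ AnswersImprovement u p σ ∧ qs.length ≤ n ∧
          ∃ α β : ℝ, BivaluedWith u α β ∧ DecidedByFlows u α β p qs := by
  refine ⟨improveProg solveNetwork, (improve solveNetwork).time + 2, fun n m u hu p F hF => ?_⟩
  obtain ⟨α, β, h, hα⟩ := hu.exists_max
  obtain ⟨hans, hpo, cs, hnodup, hmem, hqs⟩ := improve_correct h hα
    (solveNetwork_finds (p := p) hF) .nil rfl rfl (inputState_holds p)
  obtain ⟨σ, t, hr, hb, ha⟩ := runs_improveProg rfl rfl rfl hans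
  have hlt : ∀ i ∈ cs, i < n := fun i hi => ((hmem i).1 hi).1
  set cs' : List (Fin n) := cs.pmap Fin.mk hlt with hcs'
  have hmem' : ∀ i : Fin n, i ∈ cs' ↔ (bundleAt u β p i).Nonempty := by
    intro i
    rw [bundleAt_nonempty_iff h, hcs', List.mem_pmap]
    constructor
    · rintro ⟨a, ha, rfl⟩
      exact ((hmem a).1 ha).2
    · exact fun hi => ⟨i, (hmem i).2 ⟨i.2, hi⟩, rfl⟩
  have hnodup' : cs'.Nodup := hnodup.pmap fun a _ b _ hab => Fin.mk.inj hab
  have hqs' : List.Forall₂ (fun Q i => Query.IsNumberingOf Q (improvementNetwork u α p i))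
      ((improve solveNetwork).queries F u (inputState p)) cs' := by
    clear hmem hnodup hmem' hnodup' hr
    generalize (improve solveNetwork).queries F u (inputState p) = qs at hqs
    rw [hcs']
    clear hcs' cs'
    induction hqs with
    | nil => exact .nil
    | cons hQ _ ih => exact .cons hQ.2 (ih fun i hi => hlt i (List.mem_cons_of_mem _ hi))
  refine ⟨σ, t, _, hr, hb, ha, ?_, α, β, h, cs', hnodup', fun i hi => (hmem' i).1 hi, hqs', ?_,
    fun _ i hi => (hmem' i).2 hi⟩
  · rw [hqs'.length_eq]
    simpa using hnodup'.length_le_card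
  · rw [hpo]
    push Not
    constructor
    · rintro ⟨i, hi, hc, M, hM⟩
      exact ⟨⟨i, hi⟩, (hmem' _).2 ((bundleAt_nonempty_iff h p ⟨i, hi⟩).2 hc),
        maxFlow_value_iff.2 ⟨M, hM⟩⟩
    · rintro ⟨i, hi, hf⟩
      obtain ⟨M, hM⟩ := maxFlow_value_iff.1 hf
      exact ⟨i, i.2, (bundleAt_nonempty_iff h p i).1 ((hmem' i).1 hi), M, hM⟩

end ParetoAlloc

theorem mainTheorem6 :
    -- testing Pareto optimality and finding a Pareto improvement, if any, in polynomial time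
    (∃ (P : Prog) (T : Polynomial ℕ), P.CallFree ∧
      ∀ (n m : ℕ) (u : Utility n m), Bivalued u → ∀ (p : Assignment n m) (F : Solver),
        ∃ (σ : State) (t : ℕ), Runs F u P (inputState p) σ t [] ∧
          t ≤ T.eval (n + m) ∧ AnswersImprovement u p σ) ∧
    -- the same by solving at most `n` maximum-flow problems, one for each candidate agent
    (∃ (P : Prog) (T : Polynomial ℕ),
      ∀ (n m : ℕ) (u : Utility n m), Bivalued u → ∀ (p : Assignment n m) (F : Solver), F.Correct →
        ∃ (σ : State) (t : ℕ) (qs : List Query), Runs F u P (inputState p) σ t qs ∧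
          t ≤ T.eval (n + m) ∧ AnswersImprovement u p σ ∧ qs.length ≤ n ∧
          ∃ α β : ℝ, BivaluedWith u α β ∧ DecidedByFlows u α β p qs) ∧
    -- repeated Pareto improvement ends after at most `m` rounds
    (∀ (n m : ℕ) (u : Utility n m), Bivalued u → ∀ step : Assignment n m → Assignment n m,
      (∀ p, ParetoOptimal u p → step p = p) →
      (∀ p, ¬ ParetoOptimal u p → Dominates u (step p) p) →
      ∀ e : Assignment n m, ∃ k ≤ m,
        IndividuallyRational u e (step^[k] e) ∧ ParetoOptimal u (step^[k] e)) ∧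
    -- an individually rational Pareto optimal assignment in polynomial time
    (∃ (P : Prog) (T : Polynomial ℕ), P.CallFree ∧
      ∀ (n m : ℕ) (u : Utility n m), Bivalued u → ∀ (e : Assignment n m) (F : Solver),
        ∃ (σ : State) (t : ℕ), Runs F u P (inputState e) σ t [] ∧
          t ≤ T.eval (n + m) ∧ ∃ q : Assignment n m, σ.HoldsAssignment q ∧
            IndividuallyRational u e q ∧ ParetoOptimal u q) := by
  exact ⟨polynomial_time_test, polynomial_time_test_by_flows,
    fun n m u hu step h1 h2 e => by
      obtain ⟨α, β, h⟩ := hu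
      -- As `step` fixes Pareto optimal assignments, `k = m` works even if fewer replacements are
      -- made.
      exact ⟨m, le_rfl, improvement_terminates h h1 h2 e⟩,
    polynomial_time_optimum⟩
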